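/- Let $k\ge 1$ be an integer, $\alpha\in(0,1)$, $c,d>0$ and $M\in\mathbb{R}$. There is a constant $\Lambda>0$ depending only on $\alpha,k,c,d,M$ (in particular not on $n$, on the design points $z_1,\dots,z_n$, on the law of $u$, or otherwise on the class $\mathcal G$) such that the following holds. Let $q\ge 0$, let $\mathcal G$ be a class of measurable real-valued functions on $(\mathbb{R}^{1+q})^k$, and suppose that $\mathcal G$ is Euclidean$(c,d)$ for a measurable envelope $G$: $|g|\le G$ for all $g\in\mathcal G$ and, for every $0<\epsilon\le 1$ and every measure $\lambda$ with $\int G^2\,d\lambda<\infty$, there are $g_1,\dots,g_j\in\mathcal G$ with $j\le c\,\epsilon^{-d}$ such that each $g\in\mathcal G$ satisfies $\int|g-g_i|^2\,d\lambda\le\epsilon^2\int G^2\,d\lambda$ for some $i$. Let $n\ge k$, fix $z_1,\dots,z_n\in\mathbb{R}^q$, let $u_1,\dots,u_{2n}$ be independent copies of a real random variable $u$, and put $v_i=(u_i,z_i)$ and $v_{n+i}=(u_{n+i},z_i)$ for $1\le i\le n$. For a function $g$ on $(\mathbb{R}^{1+q})^k$ and $N\in\{n,2n\}$ let $$U^k_N(g)=\frac{1}{N(N-1)\cdots(N-k+1)}\sum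 g(v_{i_1},\dots,v_{i_k}),$$ the sum being over all $k$-tuples $(i_1,\dots,i_k)$ of distinct elements of $\{1,\dots,N\}$. Suppose that the envelope is square integrable at the design, with $\mathbb{E}[U^k_{2n}(G^2)]\le M$. Suppose also that for every $g\in\mathcal G$ and every $k$-tuple of distinct indices in $\{1,\dots,n\}$ the function $(x_1,\dots,x_k)\mapsto g((x_1,z_{i_1}),\dots,(x_k,z_{i_k}))$ is degenerate, i.e. for every $j$ and all fixed values of the other arguments its expectation with $x_j$ replaced by $u$ exists and is $0$. Finally assume the usual measurability of the class: for all real coefficients $a_{i_1\dots i_k}$, the function $\sup_{g\in\mathcal G}\bigl|\sum a_{i_1\dots i_k}\,g(v_{i_1},\dots,v_{i_k})\bigr|$ of $(u_1,\dots,u_{2n})$, the sum being over $k$-tuples of distinct indices in $\{1,\dots,2n\}$, is measurable for the completed product law. Then $$\mathbb{E}\Bigl[\sup_{g\in\mathcal G}\bigl|n^{k/2}U^k_n(g)\bigr|\Bigr]\le\Lambda\,\Bigl(\mathbb{E}\Bigl[\sup_{g\in\mathcal G}\{U^k_{2n}(g^2)\}^{\alpha}\Bigr]\Bigr)^{1/2}.$$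 -/

import Mathlib

open MeasureTheory ProbabilityTheory

namespace CondUStat

/-- `𝒢` is Euclidean(`c`, `d`) for the envelope `G`: `G` dominates every member of `𝒢`, and for
every `0 < ε ≤ 1` and every measure `ν` with `∫ G² dν < ∞` there are at most `c ε ^ (-d)` members
of `𝒢` such that every `g ∈ 𝒢` is within `ε² ∫ G² dν` of one of them in squared `L²(ν)` distance.
Integrals of nonnegative functions are written as lower Lebesgue integrals. -/
structure IsEuclidean {S : Type*} [MeasurableSpace S] (c d : ℝ) (𝒢 : Set (S → ℝ)) (G : S → ℝ) :
    Prop where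
  envelope : ∀ g ∈ 𝒢, ∀ s, |g s| ≤ G s
  covering : ∀ ε : ℝ, 0 < ε → ε ≤ 1 → ∀ ν : Measure S,
    ∫⁻ s, ENNReal.ofReal (G s ^ 2) ∂ν < ⊤ →
    ∃ t : Finset (S → ℝ), (∀ h ∈ t, h ∈ 𝒢) ∧ (t.card : ℝ) ≤ c * ε ^ (-d) ∧
      ∀ g ∈ 𝒢, ∃ h ∈ t, ∫⁻ s, ENNReal.ofReal (|g s - h s| ^ 2) ∂ν ≤
        ENNReal.ofReal (ε ^ 2) * ∫⁻ s, ENNReal.ofReal (G s ^ 2) ∂ν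

/-- `f` is degenerate with respect to the law `μ`: integrating out any one argument, with all the
other arguments held at arbitrary values, gives zero (the expectation being well defined). -/
def IsDegenerate {k : ℕ} (μ : Measure ℝ) (f : (Fin k → ℝ) → ℝ) : Prop :=
  ∀ (j : Fin k) (s : Fin k → ℝ),
    Integrable (fun x => f (Function.update s j x)) μ ∧
      ∫ x, f (Function.update s j x) ∂μ = 0

/-- The points `v_i = (u_i, z_i)`. -/
def points {ι : Type*} {q : ℕ} (z : ι → Fin q → ℝ) (u : ι → ℝ) : ι → ℝ × (Fin q → ℝ) :=
  fun i => (u i, z i)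

/-- The design `z_1, …, z_n, z_1, …, z_n` of the doubled sample. The index set `{1, …, 2n}` is
`Fin n ⊕ Fin n`, with `i` written as `Sum.inl i` and `n + i` written as `Sum.inr i`. -/
def doubled {n q : ℕ} (z : Fin n → Fin q → ℝ) : Fin n ⊕ Fin n → Fin q → ℝ :=
  Sum.elim z z

/-- The U-statistic of order `k` with kernel `g` at the points `v_i`, `i ∈ ι`: with `N` the number
of points, the sum of `g (v_{i_1}, …, v_{i_k})` over the `k`-tuples of distinct indices, divided by
`N (N - 1) ⋯ (N - k + 1)`. -/
noncomputable def uStat {ι S : Type*} [Fintype ι] {k : ℕ} (v : ι → S)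
    (g : (Fin k → S) → ℝ) : ℝ :=
  open scoped Classical in
  ((Fintype.card ι).descFactorial k : ℝ)⁻¹ * ∑ i : Fin k ↪ ι, g (fun j => v (i j))

/-- The usual measurability condition on a possibly uncountable class indexing a U-process: for all
real coefficients `a`, the supremum over `g ∈ 𝒢` of `|∑ a_i g (v_{i_1}, …, v_{i_k})|`, the sum being
over the `k`-tuples of distinct indices, is a measurable function of the sample `(u_i)` on the
completion of the product law. -/
def IsMeasurableClass {ι : Type*} [Fintype ι] {q k : ℕ} (μ : Measure ℝ) (z : ι → Fin q → ℝ)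
    (𝒢 : Set ((Fin k → ℝ × (Fin q → ℝ)) → ℝ)) : Prop :=
  open scoped Classical in
  ∀ a : (Fin k ↪ ι) → ℝ,
    AEMeasurable
      (fun u : ι → ℝ =>
        ⨆ g ∈ 𝒢, ENNReal.ofReal |∑ i : Fin k ↪ ι, a i * g (fun j => points z u (i j))|)
      (Measure.pi fun _ : ι => μ)

end CondUStat

/-!
The inequality is a maximal inequality for a degenerate `U`-process, obtained by symmetrization
followed by chaining conditionally on the sample.

Replace `g` by the alternating sum of its values over all ways of exchanging observations
`u_i` for their copies `u_{n+i}` at the same design point (`symKernel`). Integrating out the copies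
gives `g` back, because `g` is degenerate, so the mean of the supremum can only increase
(`lintegral_firstHalf_le`). Exchanging `u_i` with `u_{n+i}` does not change the law of the doubled
sample, and multiplies the symmetrized kernel by a product of signs (`symKernel_swapCopies`). Hence
the signs may be averaged over, and conditionally on the sample the process is a homogeneous
Rademacher chaos of order `k`, whose variance is at most a constant times `∑ g ^ 2` over the tuples
of the doubled sample.

The entropy of the class is polynomial, so moments of one fixed large order `p` suffice for the
chaining, and no exponential inequality is needed. These moments are controlled by the variance,
uniformly in the number of signs, through Bonami's inequality (`expect_pow_four_le`) and its
iteration along powers of two (`exists_hypercontractive`). With `d ≤ p (1 - α)`, chaining in the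
empirical `L²` distance from the radius `D` of the class, where `D ^ 2 = sup_g U_{2n}(g ^ 2)`, gives
a bound of order `D ^ α R ^ (1 - α)`, where `R ^ 2 = U_{2n}(G ^ 2)` (`expect_selection_le`,
`exists_sum_biSup_chaos_le`). The Cauchy–Schwarz inequality and `E R ^ 2 ≤ M` then give the claim.

Measurability of the supremum is assumed for linear functionals of the class only. The final step
therefore applies the Cauchy–Schwarz inequality to the conditional mean of the chaos divided by
`R ^ (1 - α)`, which is measurable, and not to `D ^ α` (`lintegral_le_of_le_sqrt_mul`).
-/

namespace CondUStat

/-! ### Polynomials in independent signs -/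

section Walsh

variable {ι : Type*}

/-- The Walsh function `σ ↦ ∏_{i ∈ S} σ_i` on the cube of signs `ι → ℤˣ`. -/
def walsh (S : Finset ι) (σ : ι → ℤˣ) : ℝ := ∏ i ∈ S, ((σ i : ℤ) : ℝ)

/-- The functions on the cube of signs that are polynomials of degree at most `k` in the signs with
index in `T`. -/
def walshSpan (T : Finset ι) (k : ℕ) : Submodule ℝ ((ι → ℤˣ) → ℝ) :=
  Submodule.span ℝ {f | ∃ S ⊆ T, S.card ≤ k ∧ f = walsh S}

lemma sign_sq (s : ℤˣ) : ((s : ℤ) : ℝ) ^ 2 = 1 := by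
  rcases Int.units_eq_one_or s with rfl | rfl <;> simp

lemma walsh_mul_right (S : Finset ι) (σ τ : ι → ℤˣ) :
    walsh S (σ * τ) = walsh S σ * walsh S τ := by
  simp [walsh, Finset.prod_mul_distrib]

lemma walsh_mul_walsh [Fintype ι] [DecidableEq ι] (S S' : Finset ι) :
    walsh S * walsh S' = walsh (symmDiff S S') := by
  funext σ
  have h1 : ∀ A : Finset ι, walsh A σ = ∏ i, if i ∈ A then ((σ i : ℤ) : ℝ) else 1 := by
    intro A; simp [walsh]
  simp only [Pi.mul_apply, h1, ← Finset.prod_mul_distrib]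
  refine Finset.prod_congr rfl fun i _ => ?_
  have := sign_sq (σ i)
  by_cases hS : i ∈ S <;> by_cases hS' : i ∈ S' <;> simp [hS, hS', Finset.mem_symmDiff, ← sq, this]

lemma walsh_mem_walshSpan {S T : Finset ι} {k : ℕ} (h : S ⊆ T) (hk : S.card ≤ k) :
    walsh S ∈ walshSpan T k :=
  Submodule.subset_span ⟨S, h, hk, rfl⟩

lemma mul_mem_walshSpan [Fintype ι] [DecidableEq ι] {T : Finset ι} {k l : ℕ}
    {f g : (ι → ℤˣ) → ℝ} (hf : f ∈ walshSpan T k) (hg : g ∈ walshSpan T l) : f * g ∈ walshSpan T (k + l) := by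
  refine Submodule.span_induction ?_ ?_ ?_ ?_ hf
  · rintro _ ⟨S, hS, hSk, rfl⟩
    refine Submodule.span_induction ?_ ?_ ?_ ?_ hg
    · rintro _ ⟨S', hS', hSl, rfl⟩
      rw [walsh_mul_walsh]
      refine walsh_mem_walshSpan ?_ ?_
      · intro i hi
        rcases Finset.mem_symmDiff.1 hi with h | h
        exacts [hS h.1, hS' h.1]
      · refine (Finset.card_le_card (t := S ∪ S') ?_).trans
          ((Finset.card_union_le _ _).trans (add_le_add hSk hSl))
        intro i hi
        rcases Finset.mem_symmDiff.1 hi with h | h <;> simp [h.1]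
    · simp
    · intro x y _ _ hx hy
      rw [mul_add]; exact add_mem hx hy
    · intro a x _ hx
      rw [mul_smul_comm]; exact Submodule.smul_mem _ _ hx
  · simp
  · intro x y _ _ hx hy
    rw [add_mul]; exact add_mem hx hy
  · intro a x _ hx
    rw [smul_mul_assoc]; exact Submodule.smul_mem _ _ hx

/-- A polynomial in the signs with index in `T` does not change when another sign is flipped. -/
lemma walshSpan_flip [DecidableEq ι] {T : Finset ι} {k : ℕ} {i : ι} (hi : i ∉ T) {f : (ι → ℤˣ) → ℝ}
    (hf : f ∈ walshSpan T k) (σ : ι → ℤˣ) : f (σ * Pi.mulSingle i (-1)) = f σ := by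
  refine Submodule.span_induction ?_ ?_ ?_ ?_ hf
  · rintro _ ⟨S, hS, -, rfl⟩
    have h1 : walsh S (Pi.mulSingle i (-1) : ι → ℤˣ) = 1 := by
      refine Finset.prod_eq_one fun j hj => ?_
      have : j ≠ i := fun h => hi (hS (h ▸ hj))
      simp [Pi.mulSingle_eq_of_ne this]
    rw [walsh_mul_right, h1, mul_one]
  · simp
  · intro x y _ _ hx hy
    simp [hx, hy]
  · intro a x _ hx
    simp [hx]

lemma expect_mul_sign_eq_zero [Fintype ι] [DecidableEq ι] {i : ι} {h : (ι → ℤˣ) → ℝ}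
    (hh : ∀ σ, h (σ * Pi.mulSingle i (-1)) = h σ) :
    Finset.expect Finset.univ (fun σ : ι → ℤˣ => h σ * ((σ i : ℤ) : ℝ)) = 0 := by
  have h1 : Finset.expect Finset.univ (fun σ : ι → ℤˣ => h σ * ((σ i : ℤ) : ℝ)) =
      Finset.expect Finset.univ (fun σ : ι → ℤˣ => -(h σ * ((σ i : ℤ) : ℝ))) := by
    refine Fintype.expect_equiv (Equiv.mulRight (Pi.mulSingle i (-1))) _ _ fun σ => ?_
    simp [hh]
  rw [Finset.expect_neg_distrib] at h1
  linarith

/-- A polynomial of degree at most `k` is affine in each sign, and the coefficient of that sign has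
degree at most `k - 1`. -/
lemma walshSpan_insert [DecidableEq ι] {T : Finset ι} {k : ℕ} {i : ι} {f : (ι → ℤˣ) → ℝ}
    (hf : f ∈ walshSpan (insert i T) k) :
    ∃ a ∈ walshSpan T k, ∃ b ∈ walshSpan T (k - 1), (k = 0 → b = 0) ∧
      ∀ σ, f σ = a σ + b σ * ((σ i : ℤ) : ℝ) := by
  refine Submodule.span_induction ?_ ?_ ?_ ?_ hf
  · rintro _ ⟨S, hS, hSk, rfl⟩
    by_cases hi : i ∈ S
    · refine ⟨0, zero_mem _, walsh (S.erase i), walsh_mem_walshSpan ?_ ?_, ?_, ?_⟩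
      · exact Finset.subset_insert_iff.1 hS
      · rw [Finset.card_erase_of_mem hi]; omega
      · rintro rfl
        rw [Nat.le_zero, Finset.card_eq_zero] at hSk
        simp [hSk] at hi
      · intro σ
        simp [walsh, Finset.prod_erase_mul _ _ hi]
    · refine ⟨walsh S, walsh_mem_walshSpan ?_ hSk, 0, zero_mem _, fun _ => rfl, by simp⟩
      exact (Finset.subset_insert_iff_of_notMem hi).1 hS
  · exact ⟨0, zero_mem _, 0, zero_mem _, fun _ => rfl, by simp⟩
  · rintro x y _ _ ⟨a, ha, b, hb, hb0, hx⟩ ⟨a', ha', b', hb', hb0', hy⟩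
    refine ⟨a + a', add_mem ha ha', b + b', add_mem hb hb', fun h => ?_, fun σ => ?_⟩
    · simp [hb0 h, hb0' h]
    · simp only [Pi.add_apply, hx, hy]; ring
  · rintro r x _ ⟨a, ha, b, hb, hb0, hx⟩
    refine ⟨r • a, Submodule.smul_mem _ _ ha, r • b, Submodule.smul_mem _ _ hb, fun h => ?_,
      fun σ => ?_⟩
    · simp [hb0 h]
    · simp only [Pi.smul_apply, smul_eq_mul, hx]; ring

/-- Bonami's inequality between the fourth and the second moment, by induction on the signs. -/
lemma expect_pow_four_le [Fintype ι] [DecidableEq ι] (T : Finset ι) :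
    ∀ (k : ℕ) {f : (ι → ℤˣ) → ℝ}, f ∈ walshSpan T k →
    Finset.expect Finset.univ (fun σ => f σ ^ 4) ≤
      9 ^ k * Finset.expect Finset.univ (fun σ => f σ ^ 2) ^ 2 := by
  induction T using Finset.induction_on with
  | empty =>
    intro k f hf
    obtain ⟨c, rfl⟩ : ∃ c : ℝ, f = fun _ => c := by
      refine Submodule.span_induction ?_ ?_ ?_ ?_ hf
      · rintro _ ⟨S, hS, -, rfl⟩
        rw [Finset.subset_empty] at hS
        exact ⟨1, by funext σ; simp [walsh, hS]⟩
      · exact ⟨0, rfl⟩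
      · rintro _ _ _ _ ⟨a, rfl⟩ ⟨b, rfl⟩
        exact ⟨a + b, rfl⟩
      · rintro r _ _ ⟨a, rfl⟩
        exact ⟨r * a, rfl⟩
    simp only [Fintype.expect_const]
    have : (1 : ℝ) ≤ 9 ^ k := one_le_pow₀ (by norm_num)
    nlinarith [sq_nonneg (c ^ 2)]
  | insert i T hi ih =>
    intro k f hf
    obtain ⟨a, ha, b, hb, hb0, hfab⟩ := walshSpan_insert hf
    have hfa := walshSpan_flip hi ha
    have hfb := walshSpan_flip hi hb
    -- Terms of odd degree in the sign `i` have mean zero.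
    have e4 : Finset.expect Finset.univ (fun σ => f σ ^ 4) =
        Finset.expect Finset.univ (fun σ => a σ ^ 4) +
        6 * Finset.expect Finset.univ (fun σ => a σ ^ 2 * b σ ^ 2) +
        Finset.expect Finset.univ (fun σ => b σ ^ 4) := by
      have z : Finset.expect Finset.univ (fun σ : ι → ℤˣ =>
          (4 * a σ ^ 3 * b σ + 4 * a σ * b σ ^ 3) * ((σ i : ℤ) : ℝ)) = 0 :=
        expect_mul_sign_eq_zero fun σ => by rw [hfa, hfb]
      rw [← add_zero (_ + Finset.expect _ fun σ => b σ ^ 4), ← z, Finset.mul_expect]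
      simp only [← Finset.expect_add_distrib]
      refine Finset.expect_congr rfl fun σ _ => ?_
      rw [hfab]
      have := sign_sq (σ i)
      generalize ((σ i : ℤ) : ℝ) = s at *
      linear_combination (6 * a σ ^ 2 * b σ ^ 2 + b σ ^ 4 * (s ^ 2 + 1) +
        4 * a σ * b σ ^ 3 * s) * this
    have e2 : Finset.expect Finset.univ (fun σ => f σ ^ 2) =
        Finset.expect Finset.univ (fun σ => a σ ^ 2) +
        Finset.expect Finset.univ (fun σ => b σ ^ 2) := by
      have z : Finset.expect Finset.univ (fun σ : ι → ℤˣ =>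
          (2 * a σ * b σ) * ((σ i : ℤ) : ℝ)) = 0 :=
        expect_mul_sign_eq_zero fun σ => by rw [hfa, hfb]
      rw [← add_zero (_ + Finset.expect _ fun σ => b σ ^ 2), ← z]
      simp only [← Finset.expect_add_distrib]
      refine Finset.expect_congr rfl fun σ _ => ?_
      rw [hfab]
      have := sign_sq (σ i)
      generalize ((σ i : ℤ) : ℝ) = s at *
      linear_combination b σ ^ 2 * this
    have ha4 := ih k ha
    have hb4 := ih (k - 1) hb
    have cs : Finset.expect Finset.univ (fun σ => a σ ^ 2 * b σ ^ 2) ^ 2 ≤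
        Finset.expect Finset.univ (fun σ => a σ ^ 4) *
        Finset.expect Finset.univ (fun σ => b σ ^ 4) := by
      refine (Finset.expect_mul_sq_le_sq_mul_sq Finset.univ
        (fun σ => a σ ^ 2) (fun σ => b σ ^ 2)).trans_eq ?_
      simp only [← pow_mul, Nat.reduceMul]
    have hA : 0 ≤ Finset.expect Finset.univ (fun σ => a σ ^ 2) :=
      Finset.expect_nonneg fun _ _ => sq_nonneg _
    have hB : 0 ≤ Finset.expect Finset.univ (fun σ => b σ ^ 2) :=
      Finset.expect_nonneg fun _ _ => sq_nonneg _
    have hB4 : 0 ≤ Finset.expect Finset.univ (fun σ => b σ ^ 4) :=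
      Finset.expect_nonneg fun _ _ => by positivity
    rw [e4, e2]
    rcases Nat.eq_zero_or_pos k with rfl | hk
    · have : b = 0 := hb0 rfl
      subst this
      simpa using ha4
    obtain ⟨m, rfl⟩ : ∃ m, k = m + 1 := ⟨k - 1, by omega⟩
    simp only [Nat.add_sub_cancel] at hb4
    rw [pow_succ] at ha4 ⊢
    generalize Finset.expect Finset.univ (fun σ => a σ ^ 2) = A at *
    generalize Finset.expect Finset.univ (fun σ => b σ ^ 2) = B at *
    generalize Finset.expect Finset.univ (fun σ => a σ ^ 4) = A4 at *
    generalize Finset.expect Finset.univ (fun σ => b σ ^ 4) = B4 at *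
    generalize Finset.expect Finset.univ (fun σ => a σ ^ 2 * b σ ^ 2) = X at *
    have h9 : (0 : ℝ) < 9 ^ m := by positivity
    generalize (9 : ℝ) ^ m = N at *
    -- The factors `9 ^ (m + 1)` and `9 ^ m` of the two induction hypotheses combine to
    -- `(3 * 9 ^ m) ^ 2`, so that six times the mixed moment is the middle term of the square.
    have hX : X ≤ 3 * N * A * B := by
      refine le_of_sq_le_sq ?_ (by positivity)
      calc X ^ 2 ≤ A4 * B4 := cs
        _ ≤ (N * 9 * A ^ 2) * (N * B ^ 2) := mul_le_mul ha4 hb4 hB4 (by positivity)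
        _ = (3 * N * A * B) ^ 2 := by ring
    nlinarith [mul_nonneg h9.le (sq_nonneg B)]

/-- Hypercontractivity of polynomials of bounded degree in independent signs: their moments of order
`2 ^ (r + 1)` are bounded by their variance, with a constant that does not depend on the number of
signs. -/
lemma exists_hypercontractive (r : ℕ) : ∀ k : ℕ, ∃ B : ℝ, 0 ≤ B ∧ ∀ (n : ℕ)
    (f : (Fin n → ℤˣ) → ℝ), f ∈ walshSpan Finset.univ k →
    Finset.expect Finset.univ (fun σ => f σ ^ 2 ^ (r + 1)) ≤
      B * Finset.expect Finset.univ (fun σ => f σ ^ 2) ^ 2 ^ r := by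
  induction r with
  | zero => exact fun k => ⟨1, zero_le_one, fun n f _ => by simp⟩
  | succ r ih =>
    intro k
    obtain ⟨B, hB, h⟩ := ih (k + k)
    refine ⟨B * (9 ^ k) ^ 2 ^ r, by positivity, fun n f hf => ?_⟩
    calc Finset.expect Finset.univ (fun σ => f σ ^ 2 ^ (r + 1 + 1))
        = Finset.expect Finset.univ (fun σ => (f * f) σ ^ 2 ^ (r + 1)) := by
          refine Finset.expect_congr rfl fun σ _ => ?_
          rw [Pi.mul_apply, ← sq, ← pow_mul, pow_succ' 2 (r + 1)]
      _ ≤ B * Finset.expect Finset.univ (fun σ => (f * f) σ ^ 2) ^ 2 ^ r :=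
          h n _ (mul_mem_walshSpan hf hf)
      _ = B * Finset.expect Finset.univ (fun σ => f σ ^ 4) ^ 2 ^ r := by
          simp only [Pi.mul_apply]; ring_nf
      _ ≤ B * (9 ^ k * Finset.expect Finset.univ (fun σ => f σ ^ 2) ^ 2) ^ 2 ^ r := by
          have : 0 ≤ Finset.expect Finset.univ (fun σ => f σ ^ 4) :=
            Finset.expect_nonneg fun _ _ => by positivity
          gcongr
          exact expect_pow_four_le _ k hf
      _ = _ := by
          rw [mul_pow, ← pow_mul, pow_succ' 2 r]; ring

end Walsh

/-! ### Rademacher chaos -/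

lemma expect_walsh_mul_walsh {ι : Type*} [Fintype ι] [DecidableEq ι] (S S' : Finset ι) :
    Finset.expect Finset.univ (fun σ => walsh S σ * walsh S' σ) = if S = S' then 1 else 0 := by
  have h : ∀ σ, walsh S σ * walsh S' σ = walsh (symmDiff S S') σ := fun σ => by
    rw [← walsh_mul_walsh, Pi.mul_apply]
  simp only [h]
  split_ifs with hS
  · subst hS
    simp [walsh]
  · obtain ⟨i, hi⟩ : (symmDiff S S').Nonempty := by
      rw [Finset.nonempty_iff_ne_empty]
      exact fun h0 => hS (symmDiff_eq_bot.1 h0)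
    have h1 : ∀ σ : ι → ℤˣ, walsh (symmDiff S S') σ =
        walsh ((symmDiff S S').erase i) σ * ((σ i : ℤ) : ℝ) := fun σ => by
      rw [walsh, walsh, Finset.prod_erase_mul _ _ hi]
    simp only [h1]
    exact expect_mul_sign_eq_zero fun σ =>
      walshSpan_flip (Finset.notMem_erase i _) (walsh_mem_walshSpan subset_rfl le_rfl) σ

lemma prod_sign_eq_walsh {k n : ℕ} (i : Fin k ↪ Fin n) (σ : Fin n → ℤˣ) :
    ∏ j, ((σ (i j) : ℤ) : ℝ) = walsh (Finset.univ.map i) σ := by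
  rw [walsh, Finset.prod_map]

/-- The Rademacher chaos of order `k` with coefficients `w`. -/
noncomputable def chaos {k n : ℕ} (w : (Fin k ↪ Fin n) → ℝ) (σ : Fin n → ℤˣ) : ℝ :=
  ∑ i : Fin k ↪ Fin n, w i * ∏ j, ((σ (i j) : ℤ) : ℝ)

lemma chaos_mem_walshSpan {k n : ℕ} (w : (Fin k ↪ Fin n) → ℝ) :
    chaos w ∈ walshSpan Finset.univ k := by
  have : chaos w = ∑ i : Fin k ↪ Fin n, w i • walsh (Finset.univ.map i) := by
    funext σ
    simp [chaos, prod_sign_eq_walsh]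
  rw [this]
  exact Submodule.sum_mem _ fun i _ => Submodule.smul_mem _ _
    (walsh_mem_walshSpan (Finset.subset_univ _) (by simp))

/-- At most `k ^ k` tuples of distinct indices have a given range. -/
lemma card_filter_map_eq_le {k n : ℕ} (i : Fin k ↪ Fin n) :
    (Finset.univ.filter fun i' : Fin k ↪ Fin n =>
      Finset.univ.map i = Finset.univ.map i').card ≤ k ^ k := by
  have h : (Finset.univ.filter fun i' : Fin k ↪ Fin n =>
      Finset.univ.map i = Finset.univ.map i').card ≤
      (Fintype.piFinset fun _ : Fin k => Finset.univ.map i).card := by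
    refine Finset.card_le_card_of_injOn (fun i' j => i' j) ?_ ?_
    · intro i' hi'
      have hi'' : Finset.univ.map i = Finset.univ.map i' := by simpa using hi'
      simp only [Finset.mem_coe, Fintype.mem_piFinset]
      intro j
      rw [hi'']
      exact Finset.mem_map_of_mem _ (Finset.mem_univ _)
    · intro a _ b _ hab
      exact DFunLike.coe_injective hab
  refine h.trans ?_
  simp

/-- Products of signs over different index sets are orthogonal, so the variance of a chaos is
comparable with the square sum of its coefficients. -/
lemma expect_chaos_sq_le {k n : ℕ} (w : (Fin k ↪ Fin n) → ℝ) :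
    Finset.expect Finset.univ (fun σ => chaos w σ ^ 2) ≤ (k : ℝ) ^ k * ∑ i, w i ^ 2 := by
  classical
  have h1 : Finset.expect Finset.univ (fun σ => chaos w σ ^ 2) =
      ∑ i, ∑ i', w i * w i' *
        if Finset.univ.map i = Finset.univ.map i' then (1 : ℝ) else 0 := by
    simp only [← expect_walsh_mul_walsh, Finset.mul_expect, ← Finset.expect_sum_comm]
    refine Finset.expect_congr rfl fun σ _ => ?_
    rw [sq, chaos, Finset.sum_mul_sum]
    refine Finset.sum_congr rfl fun i _ => Finset.sum_congr rfl fun i' _ => ?_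
    rw [prod_sign_eq_walsh, prod_sign_eq_walsh]; ring
  have h2 : ∑ i, ∑ i', w i * w i' *
        (if Finset.univ.map i = Finset.univ.map i' then (1 : ℝ) else 0) ≤
      ∑ i, ∑ i', (w i ^ 2 / 2 + w i' ^ 2 / 2) *
        if Finset.univ.map i = Finset.univ.map i' then (1 : ℝ) else 0 := by
    gcongr with i _ i' _
    nlinarith [sq_nonneg (w i - w i')]
  have h3 : ∑ i, ∑ i', (w i ^ 2 / 2 + w i' ^ 2 / 2) *
        (if Finset.univ.map i = Finset.univ.map i' then (1 : ℝ) else 0) =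
      ∑ i, w i ^ 2 * ∑ i' : Fin k ↪ Fin n,
        (if Finset.univ.map i = Finset.univ.map i' then (1 : ℝ) else 0) := by
    simp only [add_mul, Finset.sum_add_distrib]
    rw [Finset.sum_comm (f := fun i i' => w i' ^ 2 / 2 *
      (if Finset.univ.map i = Finset.univ.map i' then (1 : ℝ) else 0)),
      ← Finset.sum_add_distrib]
    refine Finset.sum_congr rfl fun i _ => ?_
    rw [Finset.mul_sum, ← Finset.sum_add_distrib]
    refine Finset.sum_congr rfl fun i' _ => ?_
    by_cases h : Finset.univ.map i = Finset.univ.map i'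
    · simp [h]
    · simp [h, Ne.symm h]
  rw [h1]
  refine h2.trans (h3.trans_le ?_)
  rw [Finset.mul_sum]
  refine Finset.sum_le_sum fun i _ => ?_
  rw [mul_comm]
  gcongr
  rw [Finset.sum_boole]
  exact_mod_cast card_filter_map_eq_le i

/-- Moments of order `2 ^ (r + 1)` of a Rademacher chaos are controlled by the `ℓ²` norm of its
coefficients, uniformly in the number of signs. -/
lemma exists_expect_chaos_pow_le (r k : ℕ) : ∃ B : ℝ, 0 ≤ B ∧ ∀ (n : ℕ)
    (w : (Fin k ↪ Fin n) → ℝ),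
    Finset.expect Finset.univ (fun σ => |chaos w σ| ^ 2 ^ (r + 1)) ≤
      (B * √(∑ i, w i ^ 2)) ^ 2 ^ (r + 1) := by
  obtain ⟨B, hB, h⟩ := exists_hypercontractive r k
  refine ⟨(max B 1) * (k : ℝ) ^ k, by positivity, fun n w => ?_⟩
  have hev : Even (2 ^ (r + 1)) := (even_two).pow_of_ne_zero (by omega)
  have hk : (1 : ℝ) ≤ (k : ℝ) ^ k := by
    rcases Nat.eq_zero_or_pos k with rfl | hk
    · simp
    · exact one_le_pow₀ (by exact_mod_cast hk)
  have h0 : 0 ≤ ∑ i, w i ^ 2 := Finset.sum_nonneg fun _ _ => sq_nonneg _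
  simp only [hev.pow_abs]
  have hE : 0 ≤ Finset.expect Finset.univ (fun σ => chaos w σ ^ 2) :=
    Finset.expect_nonneg fun _ _ => sq_nonneg _
  calc _ ≤ B * Finset.expect Finset.univ (fun σ => chaos w σ ^ 2) ^ 2 ^ r :=
        h n _ (chaos_mem_walshSpan w)
    _ ≤ max B 1 * ((k : ℝ) ^ k * ∑ i, w i ^ 2) ^ 2 ^ r := by
        gcongr
        · exact le_max_left _ _
        · exact expect_chaos_sq_le w
    _ ≤ (max B 1) ^ 2 ^ (r + 1) * (((k : ℝ) ^ k) ^ 2 * ∑ i, w i ^ 2) ^ 2 ^ r := by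
        gcongr
        · exact le_self_pow₀ (le_max_right _ _) (by positivity)
        · exact le_self_pow₀ hk (by norm_num)
    _ = _ := by
        rw [pow_succ' 2 r, pow_mul, pow_mul, ← mul_pow, mul_pow (_ * _), mul_pow, Real.sq_sqrt h0]
        ring

/-! ### Chaining with moments of fixed order -/

section Chaining

lemma expect_pow_le_expect_pow {Ω : Type*} [Fintype Ω] [Nonempty Ω] {y : Ω → ℝ}
    (hy : ∀ σ, 0 ≤ y σ) (p : ℕ) :
    Finset.expect Finset.univ y ^ p ≤ Finset.expect Finset.univ (fun σ => y σ ^ p) := by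
  have h := Real.pow_arith_mean_le_arith_mean_pow Finset.univ
    (fun _ : Ω => (Fintype.card Ω : ℝ)⁻¹) y (fun _ _ => by positivity) (by simp)
    (fun σ _ => hy σ) p
  simpa only [← Finset.mul_sum, Fintype.expect_eq_sum_div_card, div_eq_inv_mul] using h

variable {Ω E : Type*} [Fintype Ω] [Nonempty Ω] {X : E → Ω → ℝ} {N : E → ℝ}
  {B : ℝ} {p : ℕ}

/-- The maximal inequality for finitely many variables with bounded `p`-th moments, stated for a
selection `h` of one of them at every point. -/
lemma expect_selection_finset_le (hp : p ≠ 0) (hB : 0 ≤ B)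
    (hX : ∀ w, Finset.expect Finset.univ (fun σ => |X w σ| ^ p) ≤ (B * N w) ^ p)
    (hN : ∀ w, 0 ≤ N w) {t : Finset E} (φ : E → E) {δ : ℝ} (hδ : ∀ h ∈ t, N (φ h) ≤ δ)
    (hδ0 : 0 ≤ δ) {h : Ω → E} (hh : ∀ σ, h σ ∈ t) :
    Finset.expect Finset.univ (fun σ => |X (φ (h σ)) σ|) ≤
      (t.card : ℝ) ^ ((p : ℝ)⁻¹) * (B * δ) := by
  refine le_of_pow_le_pow_left₀ hp (by positivity) ?_
  calc _ ≤ Finset.expect Finset.univ (fun σ => |X (φ (h σ)) σ| ^ p) :=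
        expect_pow_le_expect_pow (fun _ => abs_nonneg _) p
    _ ≤ Finset.expect Finset.univ (fun σ => ∑ a ∈ t, |X (φ a) σ| ^ p) :=
        Finset.expect_le_expect fun σ _ => Finset.single_le_sum
          (f := fun a => |X (φ a) σ| ^ p) (fun _ _ => by positivity) (hh σ)
    _ = ∑ a ∈ t, Finset.expect Finset.univ (fun σ => |X (φ a) σ| ^ p) :=
        Finset.expect_sum_comm _ _ _
    _ ≤ ∑ a ∈ t, (B * δ) ^ p := by
        refine Finset.sum_le_sum fun a ha => (hX _).trans ?_
        have := hN (φ a)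
        gcongr
        exact hδ a ha
    _ = _ := by
        rw [mul_pow (_ ^ _), Real.rpow_inv_natCast_pow (by positivity) hp]; simp

/-- One link of the chain: at the scale `ε` the entropy `c ε ^ (-d)` costs at most `ε ^ (α - 1)`,
because `d ≤ p (1 - α)`. -/
lemma expect_link_le (hp : p ≠ 0) (hB : 0 ≤ B)
    (hX : ∀ w, Finset.expect Finset.univ (fun σ => |X w σ| ^ p) ≤ (B * N w) ^ p)
    (hN : ∀ w, 0 ≤ N w) {α c d R ε : ℝ} (hc : 0 ≤ c) (hd : d ≤ p * (1 - α)) (hR : 0 ≤ R)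
    (hε : 0 < ε) (hε1 : ε ≤ 1) {t : Finset E} (ht : (t.card : ℝ) ≤ c * ε ^ (-d)) (φ : E → E)
    (hδ : ∀ h ∈ t, N (φ h) ≤ 2 * ε * R) {h : Ω → E} (hh : ∀ σ, h σ ∈ t) :
    Finset.expect Finset.univ (fun σ => |X (φ (h σ)) σ|) ≤
      2 * c ^ ((p : ℝ)⁻¹) * B * R * ε ^ α := by
  refine (expect_selection_finset_le hp hB hX hN φ hδ (by positivity) hh).trans ?_
  have hp0 : (0 : ℝ) < p := by positivity
  have h1 : (t.card : ℝ) ^ ((p : ℝ)⁻¹) ≤ c ^ ((p : ℝ)⁻¹) * ε ^ (α - 1) := by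
    calc (t.card : ℝ) ^ ((p : ℝ)⁻¹) ≤ (c * ε ^ (-d)) ^ ((p : ℝ)⁻¹) := by gcongr
      _ = c ^ ((p : ℝ)⁻¹) * ε ^ (-d * (p : ℝ)⁻¹) := by
          rw [Real.mul_rpow hc (by positivity), ← Real.rpow_mul hε.le]
      _ ≤ _ := by
          refine mul_le_mul_of_nonneg_left ?_ (by positivity)
          refine Real.rpow_le_rpow_of_exponent_ge hε hε1 ?_
          rw [← div_eq_mul_inv, le_div_iff₀ hp0]
          linarith
  calc _ ≤ c ^ ((p : ℝ)⁻¹) * ε ^ (α - 1) * (B * (2 * ε * R)) := by gcongr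
    _ = 2 * c ^ ((p : ℝ)⁻¹) * B * R * (ε ^ (α - 1) * ε) := by ring
    _ = _ := by rw [← Real.rpow_add_one hε.ne', sub_add_cancel]

lemma abs_le_of_expect_pow_le (hp : p ≠ 0) (hB : 0 ≤ B)
    (hX : ∀ w, Finset.expect Finset.univ (fun σ => |X w σ| ^ p) ≤ (B * N w) ^ p)
    (hN : ∀ w, 0 ≤ N w) (w : E) (σ : Ω) : |X w σ| ≤ Fintype.card Ω * B * N w := by
  have := hN w
  have hcard : (1 : ℝ) ≤ Fintype.card Ω := by exact_mod_cast Fintype.card_pos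
  refine le_of_pow_le_pow_left₀ hp (by positivity) ?_
  calc |X w σ| ^ p ≤ ∑ σ, |X w σ| ^ p :=
        Finset.single_le_sum (f := fun σ => |X w σ| ^ p) (fun _ _ => by positivity)
          (Finset.mem_univ σ)
    _ = Fintype.card Ω * Finset.expect Finset.univ (fun σ => |X w σ| ^ p) := by
        rw [Fintype.card_mul_expect]
    _ ≤ Fintype.card Ω * (B * N w) ^ p := by gcongr; exact hX w
    _ ≤ (Fintype.card Ω : ℝ) ^ p * (B * N w) ^ p := by
        gcongr
        exact le_self_pow₀ hcard hp
    _ = _ := by rw [← mul_pow, mul_assoc]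

/-- Chaining for a process whose increments have `p`-th moments bounded by the `p`-th power of a
size function `N`, over a class `A` of polynomial entropy of exponent `d ≤ p (1 - α)`. The supremum
over the class is replaced by an arbitrary selection `w` of members of the class. -/
lemma expect_selection_le [AddCommGroup E] (hp : p ≠ 0) (hB : 0 ≤ B)
    (hX : ∀ w, Finset.expect Finset.univ (fun σ => |X w σ| ^ p) ≤ (B * N w) ^ p)
    (hsub : ∀ a b σ, X (a - b) σ = X a σ - X b σ)
    (hN : ∀ w, 0 ≤ N w) {α c d R D : ℝ} (hα : 0 < α) (hc : 0 ≤ c)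
    (hd : d ≤ p * (1 - α)) {A : Set E}
    (hcov : ∀ ε : ℝ, 0 < ε → ε ≤ 1 → ∃ t : Finset E, (∀ h ∈ t, h ∈ A) ∧
      (t.card : ℝ) ≤ c * ε ^ (-d) ∧ ∀ g ∈ A, ∃ h ∈ t, N (g - h) ≤ ε * R)
    (hD0 : 0 ≤ D) (hDR : D ≤ R) (hD : ∀ g ∈ A, N g ≤ D) {w : Ω → E} (hw : ∀ σ, w σ ∈ A) :
    Finset.expect Finset.univ (fun σ => |X (w σ) σ|) ≤
      2 * c ^ ((p : ℝ)⁻¹) * (1 - (1 / 2 : ℝ) ^ α)⁻¹ * B * (D ^ α * R ^ (1 - α)) := by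
  set q : ℝ := (1 / 2 : ℝ) ^ α with hq
  have hq0 : 0 < q := by positivity
  have hq1 : q < 1 := Real.rpow_lt_one (by norm_num) (by norm_num) hα
  have hR : 0 ≤ R := hD0.trans hDR
  have hq2 : 0 < (1 - q)⁻¹ := inv_pos.2 (by linarith)
  rcases hD0.eq_or_lt with rfl | hDpos
  · have h0 : ∀ σ, |X (w σ) σ| = 0 := fun σ => by
      refine le_antisymm ?_ (abs_nonneg _)
      refine (abs_le_of_expect_pow_le hp hB hX hN _ _).trans ?_
      have : N (w σ) = 0 := le_antisymm (hD _ (hw σ)) (hN _)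
      simp [this]
    simp only [h0, Finset.expect_const_zero]
    positivity
  have hRpos : 0 < R := hDpos.trans_le hDR
  -- The scales `2 ^ (-j) D / R`; the first one is the radius of the class.
  set ε : ℕ → ℝ := fun j => (1 / 2) ^ j * (D / R) with hε
  have hε0 : ∀ j, 0 < ε j := fun j => by simp only [hε]; positivity
  have hε1 : ∀ j, ε j ≤ 1 := fun j =>
    mul_le_one₀ (pow_le_one₀ (by norm_num) (by norm_num)) (by positivity)
      ((div_le_one hRpos).2 hDR)
  choose t htA htc htcov using fun j => hcov (ε j) (hε0 j) (hε1 j)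
  set L : ℝ := 2 * c ^ ((p : ℝ)⁻¹) * B * R with hL
  have hL0 : 0 ≤ L := by positivity
  have hεq : ∀ j, ε j ^ α = q ^ j * (D / R) ^ α := fun j => by
    simp only [hε]
    rw [Real.mul_rpow (by positivity) (by positivity), hq, ← Real.rpow_natCast,
      ← Real.rpow_natCast, ← Real.rpow_mul (by norm_num), ← Real.rpow_mul (by norm_num),
      mul_comm α]
  have hεR : ∀ j, ε (j + 1) * 2 * R = ε j * R := fun j => by simp only [hε, pow_succ]; ring
  have hε0R : ε 0 * R = D := by simp [hε, div_mul_cancel₀ _ hRpos.ne']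
  have chain : ∀ (J : ℕ) (h : Ω → E), (∀ σ, h σ ∈ t J) →
      Finset.expect Finset.univ (fun σ => |X (h σ) σ|) ≤
        ∑ j ∈ Finset.range (J + 1), L * (q ^ j * (D / R) ^ α) := by
    intro J
    induction J with
    | zero =>
      intro h hh
      have := expect_link_le hp hB hX hN hc hd hR (hε0 0) (hε1 0) (htc 0) id
        (fun a ha => (hD a (htA 0 a ha)).trans (by rw [mul_assoc, hε0R]; linarith)) hh
      rw [hεq] at this
      simpa [hL] using this
    | succ J ih =>
      intro h hh
      choose! π hπ hπN using htcov J
      have hA : ∀ σ, h σ ∈ A := fun σ => htA _ _ (hh σ)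
      have link := expect_link_le hp hB hX hN hc hd hR (hε0 (J + 1)) (hε1 (J + 1)) (htc (J + 1))
        (fun a => a - π a)
        (fun a ha => (hπN a (htA _ a ha)).trans_eq (by rw [mul_comm 2, hεR])) hh
      rw [hεq] at link
      rw [Finset.sum_range_succ]
      refine le_trans ?_ (add_le_add (ih (fun σ => π (h σ)) fun σ => hπ _ (hA σ)) link)
      rw [← Finset.expect_add_distrib]
      refine Finset.expect_le_expect fun σ _ => ?_
      have : X (h σ) σ = X (π (h σ)) σ + X (h σ - π (h σ)) σ := by rw [hsub]; ring
      rw [this]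
      exact abs_add_le _ _
  -- The part of the process below the last scale is controlled by the crude pointwise bound, which
  -- depends on the number of points of `Ω` but vanishes as `J` tends to infinity.
  have bound : ∀ J : ℕ, Finset.expect Finset.univ (fun σ => |X (w σ) σ|) ≤
      L * (D / R) ^ α * (1 - q)⁻¹ + Fintype.card Ω * B * (ε J * R) := by
    intro J
    choose! π hπ hπN using htcov J
    have h1 := chain J (fun σ => π (w σ)) fun σ => hπ _ (hw σ)
    have h2 : ∑ j ∈ Finset.range (J + 1), L * (q ^ j * (D / R) ^ α) ≤
        L * (D / R) ^ α * (1 - q)⁻¹ := by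
      have : ∑ j ∈ Finset.range (J + 1), q ^ j ≤ (1 - q)⁻¹ := by
        rw [← tsum_geometric_of_lt_one hq0.le hq1]
        exact (summable_geometric_of_lt_one hq0.le hq1).sum_le_tsum _ fun _ _ => by positivity
      calc _ = L * (D / R) ^ α * ∑ j ∈ Finset.range (J + 1), q ^ j := by
            rw [Finset.mul_sum]; exact Finset.sum_congr rfl fun _ _ => by ring
        _ ≤ _ := by gcongr
    calc _ ≤ Finset.expect Finset.univ
          (fun σ => |X (π (w σ)) σ| + Fintype.card Ω * B * (ε J * R)) := by
          refine Finset.expect_le_expect fun σ _ => ?_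
          have h3 : X (w σ) σ = X (π (w σ)) σ + X (w σ - π (w σ)) σ := by rw [hsub]; ring
          have h4 := abs_le_of_expect_pow_le hp hB hX hN (w σ - π (w σ)) σ
          have h5 : (Fintype.card Ω : ℝ) * B * N (w σ - π (w σ)) ≤
              Fintype.card Ω * B * (ε J * R) := by
            gcongr
            exact hπN _ (hw σ)
          rw [h3]
          exact (abs_add_le _ _).trans (by linarith)
      _ = Finset.expect Finset.univ (fun σ => |X (π (w σ)) σ|) +
          Fintype.card Ω * B * (ε J * R) := by
          rw [Finset.expect_add_distrib, Fintype.expect_const]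
      _ ≤ _ := by linarith
  have hlim : Filter.Tendsto
      (fun J => L * (D / R) ^ α * (1 - q)⁻¹ + Fintype.card Ω * B * (ε J * R)) Filter.atTop
      (nhds (L * (D / R) ^ α * (1 - q)⁻¹ + Fintype.card Ω * B * ((0 * (D / R)) * R))) := by
    refine Filter.Tendsto.const_add _ (Filter.Tendsto.const_mul _ (Filter.Tendsto.mul_const _ ?_))
    exact (tendsto_pow_atTop_nhds_zero_of_lt_one (by norm_num) (by norm_num)).mul_const _
  refine (ge_of_tendsto' hlim bound).trans_eq ?_
  have hRα : R * (D / R) ^ α = D ^ α * R ^ (1 - α) := by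
    rw [Real.div_rpow hD0 hR, Real.rpow_sub hRpos, Real.rpow_one]; ring
  rw [← hRα, hL]
  ring

end Chaining

/-! ### The symmetrized kernel -/

section SymmetrizedKernel

variable {k n : ℕ}

/-- The index `i` of the first half of the doubled sample if the sign is `1`, and its copy in the
second half if the sign is `-1`. -/
def pick (s : ℤˣ) (i : Fin n) : Fin n ⊕ Fin n := if s = 1 then Sum.inl i else Sum.inr i

lemma elim_pick {β : Type*} (z : Fin n → β) (s : ℤˣ) (i : Fin n) :
    Sum.elim z z (pick s i) = z i := by
  unfold pick; split_ifs <;> rfl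

lemma pick_inj {s s' : ℤˣ} {i i' : Fin n} : pick s i = pick s' i' ↔ s = s' ∧ i = i' := by
  rcases Int.units_eq_one_or s with rfl | rfl <;>
    rcases Int.units_eq_one_or s' with rfl | rfl <;> simp [pick]

/-- The tuple of indices in the doubled sample that takes the half of each entry of `i` from the
signs `e`. -/
def pickEmb (e : Fin k → ℤˣ) (i : Fin k ↪ Fin n) : Fin k ↪ Fin n ⊕ Fin n :=
  ⟨fun j => pick (e j) (i j), fun _ _ h => i.injective (pick_inj.1 h).2⟩

lemma pickEmb_injective :
    Function.Injective fun x : (Fin k ↪ Fin n) × (Fin k → ℤˣ) => pickEmb x.2 x.1 := by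
  rintro ⟨i, e⟩ ⟨i', e'⟩ h
  have h' : ∀ j, pick (e j) (i j) = pick (e' j) (i' j) := fun j => DFunLike.congr_fun h j
  ext j
  · simp [(pick_inj.1 (h' j)).2]
  · simp [(pick_inj.1 (h' j)).1]

/-- The symmetrized kernel: the alternating sum of the values of `f` over all ways of replacing
entries of the tuple `i` by their copies in the second half of the sample. -/
def symKernel (f : (Fin k ↪ Fin n ⊕ Fin n) → ℝ) (i : Fin k ↪ Fin n) : ℝ :=
  ∑ e : Fin k → ℤˣ, (∏ j, ((e j : ℤ) : ℝ)) * f (pickEmb e i)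

lemma symKernel_sub (f g : (Fin k ↪ Fin n ⊕ Fin n) → ℝ) (i : Fin k ↪ Fin n) :
    symKernel (fun I => f I - g I) i = symKernel f i - symKernel g i := by
  simp [symKernel, mul_sub]

lemma sum_symKernel_sq_le (f : (Fin k ↪ Fin n ⊕ Fin n) → ℝ) :
    ∑ i, symKernel f i ^ 2 ≤ 2 ^ k * ∑ I, f I ^ 2 := by
  have hs : ∀ e : Fin k → ℤˣ, (∏ j, ((e j : ℤ) : ℝ)) ^ 2 = 1 := fun e => by
    rw [← Finset.prod_pow]; exact Finset.prod_eq_one fun j _ => sign_sq _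
  have h1 : ∀ i, symKernel f i ^ 2 ≤ 2 ^ k * ∑ e : Fin k → ℤˣ, f (pickEmb e i) ^ 2 := fun i => by
    refine (sq_sum_le_card_mul_sum_sq (s := Finset.univ)).trans_eq ?_
    simp [mul_pow, hs]
  refine (Finset.sum_le_sum fun i _ => h1 i).trans ?_
  rw [← Finset.mul_sum]
  gcongr
  rw [← Fintype.sum_prod_type' (f := fun i e => f (pickEmb e i) ^ 2)]
  rw [← Finset.sum_image (f := fun I => f I ^ 2) (g := fun x : _ × (Fin k → ℤˣ) => pickEmb x.2 x.1)
    pickEmb_injective.injOn]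
  exact Finset.sum_le_sum_of_subset_of_nonneg (Finset.subset_univ _) fun _ _ _ => sq_nonneg _

end SymmetrizedKernel

/-! ### The conditional maximal inequality -/

lemma uStat_eq {ι S : Type*} [Fintype ι] [DecidableEq ι] {k : ℕ} (v : ι → S)
    (g : (Fin k → S) → ℝ) :
    uStat v g = ((Fintype.card ι).descFactorial k : ℝ)⁻¹ *
      ∑ i : Fin k ↪ ι, g (fun j => v (i j)) := by
  unfold uStat
  congr!

lemma uStat_mono {ι S : Type*} [Fintype ι] {k : ℕ} (v : ι → S) {f g : (Fin k → S) → ℝ}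
    (h : ∀ s, f s ≤ g s) : uStat v f ≤ uStat v g := by
  classical
  rw [uStat_eq, uStat_eq]
  gcongr
  exact h _

lemma uStat_nonneg {ι S : Type*} [Fintype ι] {k : ℕ} (v : ι → S) {g : (Fin k → S) → ℝ}
    (h : ∀ s, 0 ≤ g s) : 0 ≤ uStat v g := by
  classical
  rw [uStat_eq]
  exact mul_nonneg (by positivity) (Finset.sum_nonneg fun _ _ => h _)

/-- The covering condition for the empirical measure of the tuples of distinct sample points. -/
lemma IsEuclidean.covering_uStat {ι S : Type*} [Fintype ι] [MeasurableSpace S]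
    [MeasurableSingletonClass S] {k : ℕ} {c d : ℝ} {𝒢 : Set ((Fin k → S) → ℝ)}
    {G : (Fin k → S) → ℝ} (h𝒢 : IsEuclidean c d 𝒢 G) (v : ι → S) {ε : ℝ} (hε : 0 < ε)
    (hε1 : ε ≤ 1) :
    ∃ t : Finset ((Fin k → S) → ℝ), (∀ h ∈ t, h ∈ 𝒢) ∧ (t.card : ℝ) ≤ c * ε ^ (-d) ∧
      ∀ g ∈ 𝒢, ∃ h ∈ t, √(uStat v fun s => (g - h) s ^ 2) ≤ ε * √(uStat v fun s => G s ^ 2) := by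
  classical
  have hint : ∀ f : (Fin k → S) → ℝ, (∀ s, 0 ≤ f s) →
      ∫⁻ s, ENNReal.ofReal (f s) ∂(∑ i : Fin k ↪ ι, Measure.dirac fun j => v (i j)) =
        ENNReal.ofReal (∑ i : Fin k ↪ ι, f fun j => v (i j)) := fun f hf => by
    rw [lintegral_finsetSum_measure, ENNReal.ofReal_sum_of_nonneg fun _ _ => hf _]
    simp only [lintegral_dirac]
  obtain ⟨t, ht, hc, hcov⟩ := h𝒢.covering ε hε hε1
    (∑ i : Fin k ↪ ι, Measure.dirac fun j => v (i j))
    (by rw [hint _ fun _ => sq_nonneg _]; exact ENNReal.ofReal_lt_top)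
  refine ⟨t, ht, hc, fun g hg => ?_⟩
  obtain ⟨h, hh, hle⟩ := hcov g hg
  refine ⟨h, hh, ?_⟩
  have hG : 0 ≤ ∑ i : Fin k ↪ ι, G (fun j => v (i j)) ^ 2 :=
    Finset.sum_nonneg fun _ _ => sq_nonneg _
  rw [hint _ fun _ => sq_nonneg _, hint _ fun _ => sq_nonneg _,
    ← ENNReal.ofReal_mul (sq_nonneg _), ENNReal.ofReal_le_ofReal_iff (by positivity)] at hle
  rw [← Real.sqrt_sq hε.le, ← Real.sqrt_mul (sq_nonneg _), uStat_eq, uStat_eq]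
  refine Real.sqrt_le_sqrt ?_
  calc _ ≤ ((Fintype.card ι).descFactorial k : ℝ)⁻¹ *
        (ε ^ 2 * ∑ i : Fin k ↪ ι, G (fun j => v (i j)) ^ 2) := by
        gcongr
        simpa only [sq_abs, Pi.sub_apply] using hle
    _ = _ := by ring

/-- Suprema over a common index set that are taken separately at each point of a finite set amount
to a supremum over selections. -/
lemma sum_biSup_le_of_selection {Ω E : Type*} [Fintype Ω] {A : Set E} {f : Ω → E → ENNReal}
    {C : ENNReal} (h : ∀ w : Ω → E, (∀ σ, w σ ∈ A) → ∑ σ, f σ (w σ) ≤ C) :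
    ∑ σ, ⨆ g ∈ A, f σ g ≤ C := by
  classical
  rcases A.eq_empty_or_nonempty with rfl | hA
  · simp
  have : Nonempty A := hA.to_subtype
  have key : ∀ s : Finset Ω, ∑ σ ∈ s, ⨆ g : A, f σ g ≤ ⨆ w : Ω → A, ∑ σ ∈ s, f σ (w σ) := by
    intro s
    induction s using Finset.induction_on with
    | empty => simp
    | insert a s ha ih =>
      rw [Finset.sum_insert ha]
      refine (add_le_add le_rfl ih).trans (ENNReal.iSup_add_iSup_le fun g w => ?_)
      refine le_trans (le_of_eq ?_) (le_iSup _ (Function.update w a g))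
      rw [Finset.sum_insert ha, Function.update_self]
      congr 1
      refine Finset.sum_congr rfl fun σ hσ => ?_
      rw [Function.update_of_ne (ne_of_mem_of_not_mem hσ ha)]
  simp only [iSup_subtype'] at key ⊢
  exact (key Finset.univ).trans (iSup_le fun w => h _ fun σ => (w σ).2)

/-- Conditionally on the doubled sample `v`, the symmetrized process is a Rademacher chaos. Chaining
in the empirical `L²` distance bounds the mean of its supremum by the product of powers of the
radius of the class and of the norm of its envelope. -/
lemma exists_sum_biSup_chaos_le (k : ℕ) {α : ℝ} (hα : α ∈ Set.Ioo (0 : ℝ) 1) {c : ℝ}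
    (hc : 0 ≤ c) (d : ℝ) : ∃ K : ℝ, 0 ≤ K ∧
    ∀ (S : Type) [MeasurableSpace S] [MeasurableSingletonClass S] (𝒢 : Set ((Fin k → S) → ℝ))
      (G : (Fin k → S) → ℝ), IsEuclidean c d 𝒢 G → ∀ (n : ℕ) (v : Fin n ⊕ Fin n → S),
    ∑ σ, (⨆ g ∈ 𝒢, ENNReal.ofReal |chaos (symKernel fun I => g fun j => v (I j)) σ|) ≤
      Fintype.card (Fin n → ℤˣ) * (ENNReal.ofReal (K * √((2 * n).descFactorial k)) *
        (⨆ g ∈ 𝒢, ENNReal.ofReal ((uStat v fun s => g s ^ 2) ^ α)) ^ ((1 : ℝ) / 2) *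
        ENNReal.ofReal (uStat v fun s => G s ^ 2) ^ ((1 - α) / 2)) := by
  obtain ⟨hα0, hα1⟩ := hα
  obtain ⟨r, hr⟩ : ∃ r : ℕ, d / (1 - α) ≤ 2 ^ (r + 1) := by
    obtain ⟨r, hr⟩ := pow_unbounded_of_one_lt (d / (1 - α)) (one_lt_two (α := ℝ))
    exact ⟨r, hr.le.trans (pow_le_pow_right₀ one_le_two (Nat.le_succ r))⟩
  rw [div_le_iff₀ (by linarith)] at hr
  obtain ⟨B, hB, hchaos⟩ := exists_expect_chaos_pow_le r k
  -- The order of the moments used in the chaining.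
  obtain ⟨p, hp⟩ : ∃ p : ℕ, p = 2 ^ (r + 1) := ⟨_, rfl⟩
  have hp0 : p ≠ 0 := by rw [hp]; positivity
  replace hr : d ≤ p * (1 - α) := by rw [hp]; push_cast; exact hr
  rw [← hp] at hchaos
  have hq1 : (1 / 2 : ℝ) ^ α < 1 := Real.rpow_lt_one (by norm_num) (by norm_num) hα0
  have hq2 : 0 < (1 - (1 / 2 : ℝ) ^ α)⁻¹ := inv_pos.2 (by linarith)
  refine ⟨2 * c ^ ((p : ℝ)⁻¹) * (1 - (1 / 2 : ℝ) ^ α)⁻¹ * (B * √(2 ^ k)),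
    by positivity, ?_⟩
  intro S _ _ 𝒢 G h𝒢 n v
  set N : ((Fin k → S) → ℝ) → ℝ := fun g => √(uStat v fun s => g s ^ 2) with hNdef
  set F : ℝ := (((2 * n).descFactorial k : ℕ) : ℝ) with hF
  have hcardι : Fintype.card (Fin n ⊕ Fin n) = 2 * n := by simp [two_mul]
  have hX : ∀ g : (Fin k → S) → ℝ, Finset.expect Finset.univ
      (fun σ => |chaos (symKernel fun I => g fun j => v (I j)) σ| ^ p) ≤
      (B * √(2 ^ k) * √F * N g) ^ p := fun g => by
    refine (hchaos n _).trans ?_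
    rw [mul_assoc, mul_assoc]
    gcongr
    rw [hNdef, ← Real.sqrt_mul (by positivity), ← Real.sqrt_mul (by positivity)]
    refine Real.sqrt_le_sqrt ((sum_symKernel_sq_le _).trans ?_)
    gcongr
    rw [uStat_eq, hcardι, ← mul_assoc]
    rcases Nat.eq_zero_or_pos ((2 * n).descFactorial k) with h0 | h0
    · -- There are no tuples at all when `2 n < k`.
      have : IsEmpty (Fin k ↪ Fin n ⊕ Fin n) := by
        refine ⟨fun e => ?_⟩
        have := Fintype.card_le_of_embedding e
        rw [hcardι, Fintype.card_fin] at this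
        rw [Nat.descFactorial_eq_zero_iff_lt] at h0
        omega
      simp
    · rw [mul_inv_cancel₀ (by positivity), one_mul]
  set R : ℝ := uStat v fun s => G s ^ 2 with hRdef
  have hR0 : 0 ≤ R := uStat_nonneg v fun _ => sq_nonneg _
  set T : ENNReal := ⨆ g ∈ 𝒢, ENNReal.ofReal ((uStat v fun s => g s ^ 2) ^ α) with hT
  have hU : ∀ g ∈ 𝒢, (uStat v fun s => g s ^ 2) ≤ R := fun g hg => uStat_mono v fun s => by
    exact sq_le_sq' (abs_le.1 (h𝒢.envelope g hg s)).1 (abs_le.1 (h𝒢.envelope g hg s)).2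
  have hU0 : ∀ g : (Fin k → S) → ℝ, 0 ≤ (uStat v fun s => g s ^ 2) := fun g =>
    uStat_nonneg v fun _ => sq_nonneg _
  have hTR : T ≤ ENNReal.ofReal (R ^ α) := iSup₂_le fun g hg => by
    gcongr
    · exact hU0 g
    · exact hU g hg
  have hTtop : T ≠ ⊤ := ne_top_of_le_ne_top ENNReal.ofReal_ne_top hTR
  set s : ℝ := T.toReal with hs
  have hs0 : 0 ≤ s := ENNReal.toReal_nonneg
  have hsR : s ≤ R ^ α := ENNReal.toReal_le_of_le_ofReal (by positivity) hTR
  have hsU : ∀ g ∈ 𝒢, (uStat v fun s => g s ^ 2) ^ α ≤ s := fun g hg => by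
    rw [hs, ← ENNReal.ofReal_le_iff_le_toReal hTtop]
    exact le_iSup₂ (f := fun g (_ : g ∈ 𝒢) => ENNReal.ofReal ((uStat v fun s => g s ^ 2) ^ α)) g hg
  have hroot : ∀ x : ℝ, 0 ≤ x → √x = (x ^ α) ^ (1 / (2 * α)) := fun x hx => by
    rw [← Real.rpow_mul hx, Real.sqrt_eq_rpow]
    congr 1; field_simp
  have hD : ∀ g ∈ 𝒢, N g ≤ s ^ (1 / (2 * α)) := fun g hg => by
    rw [hNdef]
    simp only
    rw [hroot _ (hU0 g)]
    have := hU0 g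
    exact Real.rpow_le_rpow (by positivity) (hsU g hg) (by positivity)
  have hDR : s ^ (1 / (2 * α)) ≤ √R := by
    rw [hroot _ hR0]
    exact Real.rpow_le_rpow hs0 hsR (by positivity)
  -- `s ^ (1 / (2 * α))` is the radius of the class in the distance given by `N`.
  refine sum_biSup_le_of_selection fun w hw => ?_
  have hcov : ∀ ε : ℝ, 0 < ε → ε ≤ 1 → ∃ t : Finset ((Fin k → S) → ℝ), (∀ h ∈ t, h ∈ 𝒢) ∧
      (t.card : ℝ) ≤ c * ε ^ (-d) ∧ ∀ g ∈ 𝒢, ∃ h ∈ t, N (g - h) ≤ ε * √R :=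
    fun ε hε hε1 => h𝒢.covering_uStat v hε hε1
  have hsub : ∀ (a b : (Fin k → S) → ℝ) (σ : Fin n → ℤˣ),
      chaos (symKernel fun I => (a - b) fun j => v (I j)) σ =
        chaos (symKernel fun I => a fun j => v (I j)) σ -
          chaos (symKernel fun I => b fun j => v (I j)) σ := fun a b σ => by
    simp only [Pi.sub_apply, chaos, symKernel_sub, sub_mul, Finset.sum_sub_distrib]
  have hN0 : ∀ g, 0 ≤ N g := fun g => Real.sqrt_nonneg _
  have hBF : 0 ≤ B * √(2 ^ k) * √F := by positivity
  have main := expect_selection_le (E := (Fin k → S) → ℝ) (p := p) (N := N) (A := 𝒢) (R := √R)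
    (D := s ^ (1 / (2 * α))) (B := B * √(2 ^ k) * √F) (w := w) (c := c) (d := d) (α := α)
    (X := fun g σ => chaos (symKernel fun I => g fun j => v (I j)) σ)
    hp0 hBF hX hsub hN0 hα0 hc hr hcov (Real.rpow_nonneg hs0 _) hDR hD hw
  have e1 : (s ^ (1 / (2 * α))) ^ α = s ^ ((1 : ℝ) / 2) := by
    rw [← Real.rpow_mul hs0]; congr 1; field_simp
  have e2 : √R ^ (1 - α) = R ^ ((1 - α) / 2) := by
    rw [Real.sqrt_eq_rpow, ← Real.rpow_mul hR0]; congr 1; ring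
  rw [e1, e2] at main
  rw [← ENNReal.ofReal_sum_of_nonneg fun _ _ => abs_nonneg _, ← Fintype.card_mul_expect,
    ENNReal.ofReal_mul (by positivity), ENNReal.ofReal_natCast]
  gcongr
  refine (ENNReal.ofReal_le_ofReal main).trans_eq ?_
  rw [← ENNReal.ofReal_toReal hTtop, ← hs, ENNReal.ofReal_rpow_of_nonneg hs0 (by norm_num),
    ENNReal.ofReal_rpow_of_nonneg hR0 (by linarith), ← ENNReal.ofReal_mul (by positivity),
    ← ENNReal.ofReal_mul (by positivity)]
  congr 1
  ring

/-! ### Exchanging observations with their copies -/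

section Swap

variable {n : ℕ}

lemma pick_one (i : Fin n) : pick 1 i = Sum.inl i := rfl

lemma pick_neg_one (i : Fin n) : pick (-1) i = Sum.inr i := rfl

/-- The permutation of the doubled index set that exchanges `i` with its copy when `σ i = -1`. -/
def swapCopies (σ : Fin n → ℤˣ) : Equiv.Perm (Fin n ⊕ Fin n) :=
  Function.Involutive.toPerm (Sum.elim (fun i => pick (σ i) i) fun i => pick (-σ i) i) <| by
    rintro (i | i) <;> rcases Int.units_eq_one_or (σ i) with h | h <;>
      simp [h, pick_one, pick_neg_one]

lemma swapCopies_pick (σ : Fin n → ℤˣ) (s : ℤˣ) (i : Fin n) :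
    swapCopies σ (pick s i) = pick (σ i * s) i := by
  rcases Int.units_eq_one_or s with rfl | rfl
  · rw [mul_one]; rfl
  · rw [mul_neg_one]; rfl

lemma measurePreserving_comp_perm {ι : Type*} [Fintype ι] (μ : Measure ℝ) [SigmaFinite μ]
    (e : Equiv.Perm ι) : MeasurePreserving
      (⇑(MeasurableEquiv.arrowCongr' e.symm (MeasurableEquiv.refl ℝ)))
      (Measure.pi fun _ : ι => μ) (Measure.pi fun _ : ι => μ) :=
  measurePreserving_arrowCongr' (fun _ => μ) (fun _ => μ) _ _ fun _ => MeasurePreserving.id μ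

lemma lintegral_comp_perm {ι : Type*} [Fintype ι] (μ : Measure ℝ) [SigmaFinite μ]
    (e : Equiv.Perm ι) (F : (ι → ℝ) → ENNReal) :
    ∫⁻ u, F (u ∘ e) ∂(Measure.pi fun _ : ι => μ) = ∫⁻ u, F u ∂(Measure.pi fun _ : ι => μ) :=
  (measurePreserving_comp_perm μ e).lintegral_comp_emb (MeasurableEquiv.measurableEmbedding _) F

end Swap

/-! ### Symmetrization -/

/-- A function on a product whose integral over one coordinate always vanishes has integral zero. -/
lemma integral_pi_eq_zero {n : ℕ} {μ : Measure ℝ} [IsProbabilityMeasure μ] {f : (Fin n → ℝ) → ℝ}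
    (i : Fin n) (h : ∀ y, ∫ t, f (Function.update y i t) ∂μ = 0) :
    ∫ y, f y ∂(Measure.pi fun _ : Fin n => μ) = 0 := by
  by_cases hf : Integrable f (Measure.pi fun _ : Fin n => μ)
  swap
  -- The integral of a function that is not integrable is zero by convention.
  · exact integral_undef hf
  obtain ⟨m, rfl⟩ : ∃ m, n = m + 1 := ⟨n - 1, by have := i.pos; omega⟩
  have mp := (measurePreserving_piFinSuccAbove (fun _ : Fin (m + 1) => μ) i).symm
  rw [← mp.integral_comp' f, integral_prod_symm]
  · have : ∀ (y : Fin m → ℝ) (t : ℝ),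
        (MeasurableEquiv.piFinSuccAbove (fun _ : Fin (m + 1) => ℝ) i).symm (t, y) =
          Function.update (i.insertNth (0 : ℝ) y : Fin (m + 1) → ℝ) i t := fun y t => by
      rw [Fin.update_insertNth]; rfl
    simp only [this, h, integral_zero]
  · exact (mp.integrable_comp_emb (MeasurableEquiv.measurableEmbedding _)).2 hf

section Symmetrization

variable {k n q : ℕ}

/-- The values of the kernel `g` at the tuples of points of the doubled sample. -/
abbrev tupleValue (z : Fin n → Fin q → ℝ) (u : Fin n ⊕ Fin n → ℝ)
    (g : (Fin k → ℝ × (Fin q → ℝ)) → ℝ) : (Fin k ↪ Fin n ⊕ Fin n) → ℝ :=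
  fun I => g fun j => points (doubled z) u (I j)

lemma points_pick (z : Fin n → Fin q → ℝ) (u : Fin n ⊕ Fin n → ℝ) (s : ℤˣ) (i : Fin n) :
    points (doubled z) u (pick s i) = (u (pick s i), z i) :=
  Prod.ext rfl (elim_pick z s i)

lemma measurable_tupleValue (z : Fin n → Fin q → ℝ) {g : (Fin k → ℝ × (Fin q → ℝ)) → ℝ}
    (hg : Measurable g) (I : Fin k ↪ Fin n ⊕ Fin n) : Measurable fun u => tupleValue z u g I := by
  unfold tupleValue points
  fun_prop

/-- Exchanging observations with their copies multiplies the symmetrized kernel by signs, since the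
two copies share a design point. -/
lemma symKernel_swapCopies (z : Fin n → Fin q → ℝ) (u : Fin n ⊕ Fin n → ℝ)
    (g : (Fin k → ℝ × (Fin q → ℝ)) → ℝ) (σ : Fin n → ℤˣ) (i : Fin k ↪ Fin n) :
    symKernel (tupleValue z (u ∘ swapCopies σ) g) i =
      symKernel (tupleValue z u g) i * ∏ j, ((σ (i j) : ℤ) : ℝ) := by
  rw [symKernel, symKernel, Finset.sum_mul]
  refine Fintype.sum_equiv (Equiv.mulLeft fun j => σ (i j)) _ _ fun e => ?_
  have h1 : tupleValue z (u ∘ swapCopies σ) g (pickEmb e i) =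
      tupleValue z u g (pickEmb ((fun j => σ (i j)) * e) i) := by
    unfold tupleValue
    congr 1
    funext j
    change points (doubled z) _ (pick _ _) = points (doubled z) _ (pick _ _)
    rw [points_pick, points_pick, Function.comp, swapCopies_pick]
    rfl
  have h2 : (∏ j, ((σ (i j) : ℤ) : ℝ)) * ∏ j, ((σ (i j) : ℤ) : ℝ) = 1 := by
    rw [← Finset.prod_mul_distrib]
    exact Finset.prod_eq_one fun j _ => by rw [← sq, sign_sq]
  rw [h1]
  simp only [Equiv.coe_mulLeft, Pi.mul_apply, Units.val_mul, Int.cast_mul,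
    Finset.prod_mul_distrib]
  linear_combination (-(∏ j, ((e j : ℤ) : ℝ)) *
    tupleValue z u g (pickEmb ((fun j => σ (i j)) * e) i)) * h2

lemma lintegral_chaos_eq (μ : Measure ℝ) [IsProbabilityMeasure μ] (z : Fin n → Fin q → ℝ)
    (𝒢 : Set ((Fin k → ℝ × (Fin q → ℝ)) → ℝ)) (σ : Fin n → ℤˣ) :
    ∫⁻ u, (⨆ g ∈ 𝒢, ENNReal.ofReal |chaos (symKernel (tupleValue z u g)) σ|)
        ∂(Measure.pi fun _ : Fin n ⊕ Fin n => μ) =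
      ∫⁻ u, (⨆ g ∈ 𝒢, ENNReal.ofReal |∑ i, symKernel (tupleValue z u g) i|)
        ∂(Measure.pi fun _ : Fin n ⊕ Fin n => μ) := by
  simp only [chaos, ← symKernel_swapCopies]
  exact lintegral_comp_perm μ (swapCopies σ) fun u =>
    ⨆ g ∈ 𝒢, ENNReal.ofReal |∑ i, symKernel (tupleValue z u g) i|

/-- The measurability condition on the class covers every finite linear combination of values of the
kernels at tuples of distinct sample points, with repetitions allowed. -/
lemma IsMeasurableClass.aemeasurable_sum {μ : Measure ℝ} {z : Fin n → Fin q → ℝ}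
    {𝒢 : Set ((Fin k → ℝ × (Fin q → ℝ)) → ℝ)} (h : IsMeasurableClass μ (doubled z) 𝒢)
    {T : Type*} [Fintype T] (φ : T → (Fin k ↪ Fin n ⊕ Fin n)) (b : T → ℝ) :
    AEMeasurable (fun u => ⨆ g ∈ 𝒢, ENNReal.ofReal |∑ t, b t * tupleValue z u g (φ t)|)
      (Measure.pi fun _ : Fin n ⊕ Fin n => μ) := by
  classical
  convert h fun I => ∑ t, if φ t = I then b t else 0 using 7 with u g hg
  simp only [Finset.sum_mul, ite_mul, zero_mul]
  rw [Finset.sum_comm]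
  refine Finset.sum_congr rfl fun t _ => ?_
  rw [Finset.sum_eq_single (φ t)]
  · simp
  · intro I _ hI; simp [hI.symm]
  · simp

lemma aemeasurable_chaos {μ : Measure ℝ} {z : Fin n → Fin q → ℝ}
    {𝒢 : Set ((Fin k → ℝ × (Fin q → ℝ)) → ℝ)} (h : IsMeasurableClass μ (doubled z) 𝒢)
    (σ : Fin n → ℤˣ) :
    AEMeasurable (fun u => ⨆ g ∈ 𝒢, ENNReal.ofReal |chaos (symKernel (tupleValue z u g)) σ|)
      (Measure.pi fun _ : Fin n ⊕ Fin n => μ) := by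
  convert h.aemeasurable_sum (T := (Fin k ↪ Fin n) × (Fin k → ℤˣ)) (fun t => pickEmb t.2 t.1)
    (fun t => (∏ j, ((σ (t.1 j) : ℤ) : ℝ)) * ∏ j, ((t.2 j : ℤ) : ℝ)) using 7 with u g hg
  rw [Fintype.sum_prod_type, chaos]
  refine Finset.sum_congr rfl fun i _ => ?_
  rw [symKernel, Finset.sum_mul]
  exact Finset.sum_congr rfl fun e _ => by ring

lemma aemeasurable_symKernel {μ : Measure ℝ} {z : Fin n → Fin q → ℝ}
    {𝒢 : Set ((Fin k → ℝ × (Fin q → ℝ)) → ℝ)} (h : IsMeasurableClass μ (doubled z) 𝒢) :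
    AEMeasurable (fun u => ⨆ g ∈ 𝒢, ENNReal.ofReal |∑ i, symKernel (tupleValue z u g) i|)
      (Measure.pi fun _ : Fin n ⊕ Fin n => μ) := by
  simpa [chaos] using aemeasurable_chaos h 1

lemma aemeasurable_firstHalf {μ : Measure ℝ} {z : Fin n → Fin q → ℝ}
    {𝒢 : Set ((Fin k → ℝ × (Fin q → ℝ)) → ℝ)} (h : IsMeasurableClass μ (doubled z) 𝒢) :
    AEMeasurable (fun u => ⨆ g ∈ 𝒢, ENNReal.ofReal |∑ i, tupleValue z u g (pickEmb 1 i)|)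
      (Measure.pi fun _ : Fin n ⊕ Fin n => μ) := by
  simpa using h.aemeasurable_sum (T := Fin k ↪ Fin n) (pickEmb 1) 1

/-- Integrating out the second half of the sample removes, by degeneracy, every term of the
symmetrized kernel that involves a copy. -/
lemma integral_sum_symKernel {μ : Measure ℝ} [IsProbabilityMeasure μ] {z : Fin n → Fin q → ℝ}
    {g : (Fin k → ℝ × (Fin q → ℝ)) → ℝ}
    (hdeg : ∀ i : Fin k ↪ Fin n, IsDegenerate μ fun x : Fin k → ℝ => g fun j => (x j, z (i j)))
    {x : Fin n → ℝ} (hint : ∀ I, Integrable (fun y => tupleValue z (Sum.elim x y) g I)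
      (Measure.pi fun _ : Fin n => μ)) (y₀ : Fin n → ℝ) :
    ∫ y, ∑ i, symKernel (tupleValue z (Sum.elim x y) g) i ∂(Measure.pi fun _ : Fin n => μ) =
      ∑ i, tupleValue z (Sum.elim x y₀) g (pickEmb 1 i) := by
  unfold symKernel
  rw [integral_finsetSum _ fun i _ => integrable_finsetSum _ fun e _ => (hint _).const_mul _]
  refine Finset.sum_congr rfl fun i _ => ?_
  rw [integral_finsetSum _ fun e _ => (hint _).const_mul _, Finset.sum_eq_single 1]
  · have : ∀ y, tupleValue z (Sum.elim x y) g (pickEmb 1 i) =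
        tupleValue z (Sum.elim x y₀) g (pickEmb 1 i) := fun y => rfl
    simp [this]
  · intro e _ he
    obtain ⟨j, hj⟩ : ∃ j, e j = -1 := by
      by_contra! h
      exact he (funext fun j => (Int.units_eq_one_or (e j)).resolve_right (h j))
    rw [integral_const_mul, integral_pi_eq_zero (i j), mul_zero]
    intro y
    refine Eq.trans ?_ ((hdeg i j fun j' => Sum.elim x y (pick (e j') (i j'))).2)
    refine integral_congr_ae (Filter.Eventually.of_forall fun t => ?_)
    change g _ = g _
    congr 1
    funext j'
    change points (doubled z) _ (pick (e j') (i j')) = _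
    rw [points_pick]
    congr 1
    by_cases hjj : j' = j
    · subst hjj
      simp [hj, pick_neg_one]
    · have : i j' ≠ i j := fun h => hjj (i.injective h)
      rcases Int.units_eq_one_or (e j') with h | h <;>
        simp [h, pick_one, pick_neg_one, Function.update_of_ne hjj, Function.update_of_ne this]
  · simp

/-- Symmetrization: adding the independent copies can only increase the mean of the supremum. -/
lemma lintegral_firstHalf_le {μ : Measure ℝ} [IsProbabilityMeasure μ] {z : Fin n → Fin q → ℝ}
    {𝒢 : Set ((Fin k → ℝ × (Fin q → ℝ)) → ℝ)} {G : (Fin k → ℝ × (Fin q → ℝ)) → ℝ}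
    (h𝒢 : ∀ g ∈ 𝒢, Measurable g) (henv : ∀ g ∈ 𝒢, ∀ s, |g s| ≤ G s)
    (hcls : IsMeasurableClass μ (doubled z) 𝒢)
    (hG : ∀ I, Integrable (fun u => tupleValue z u G I)
      (Measure.pi fun _ : Fin n ⊕ Fin n => μ))
    (hdeg : ∀ g ∈ 𝒢, ∀ i : Fin k ↪ Fin n,
      IsDegenerate μ fun x : Fin k → ℝ => g fun j => (x j, z (i j))) :
    ∫⁻ u, (⨆ g ∈ 𝒢, ENNReal.ofReal |∑ i, tupleValue z u g (pickEmb 1 i)|)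
        ∂(Measure.pi fun _ : Fin n ⊕ Fin n => μ) ≤
      ∫⁻ u, (⨆ g ∈ 𝒢, ENNReal.ofReal |∑ i, symKernel (tupleValue z u g) i|)
        ∂(Measure.pi fun _ : Fin n ⊕ Fin n => μ) := by
  have mp := measurePreserving_sumPiEquivProdPi_symm (fun _ : Fin n ⊕ Fin n => μ)
  have hemb := MeasurableEquiv.measurableEmbedding
    (MeasurableEquiv.sumPiEquivProdPi (fun _ : Fin n ⊕ Fin n => ℝ)).symm
  have hsymm : ∀ x y : Fin n → ℝ,
      (MeasurableEquiv.sumPiEquivProdPi (fun _ : Fin n ⊕ Fin n => ℝ)).symm (x, y) =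
        Sum.elim x y := fun x y => by
    funext i; cases i <;> rfl
  rw [← mp.lintegral_comp_emb hemb, ← mp.lintegral_comp_emb hemb, lintegral_prod, lintegral_prod]
  rotate_left
  · exact (aemeasurable_symKernel hcls).comp_quasiMeasurePreserving mp.quasiMeasurePreserving
  · exact (aemeasurable_firstHalf hcls).comp_quasiMeasurePreserving mp.quasiMeasurePreserving
  simp only [hsymm]
  -- For almost every first half, the envelope makes all kernels of the class integrable in the second
  -- half at once, outside a null set that does not depend on the kernel.
  have hint : ∀ᵐ x ∂(Measure.pi fun _ : Fin n => μ), ∀ I,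
      Integrable (fun y => tupleValue z (Sum.elim x y) G I) (Measure.pi fun _ : Fin n => μ) := by
    rw [ae_all_iff]
    intro I
    have := ((mp.integrable_comp_emb hemb).2 (hG I)).prod_right_ae
    simpa only [Function.comp, hsymm] using this
  refine lintegral_mono_ae (hint.mono fun x hx => ?_)
  have hconst : ∀ y : Fin n → ℝ,
      (⨆ g ∈ 𝒢, ENNReal.ofReal |∑ i, tupleValue z (Sum.elim x y) g (pickEmb 1 i)|) =
        ⨆ g ∈ 𝒢, ENNReal.ofReal |∑ i, tupleValue z (Sum.elim x x) g (pickEmb 1 i)| :=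
    fun y => rfl
  simp only [hconst, lintegral_const, measure_univ, mul_one]
  refine iSup₂_le fun g hg => ?_
  have hgint : ∀ I, Integrable (fun y => tupleValue z (Sum.elim x y) g I)
      (Measure.pi fun _ : Fin n => μ) := fun I => by
    refine (hx I).mono ?_ (Filter.Eventually.of_forall fun y => ?_)
    · have : Measurable fun y : Fin n → ℝ => (Sum.elim x y : Fin n ⊕ Fin n → ℝ) := by
        rw [measurable_pi_iff]
        rintro (i | i)
        exacts [measurable_const, measurable_pi_apply i]
      exact ((measurable_tupleValue z (h𝒢 g hg) I).comp this).aestronglyMeasurable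
    · exact (henv g hg _).trans (le_abs_self _)
  rw [← integral_sum_symKernel (hdeg g hg) hgint x, ← Real.enorm_eq_ofReal_abs]
  refine (enorm_integral_le_lintegral_enorm _).trans (lintegral_mono fun y => ?_)
  rw [Real.enorm_eq_ofReal_abs]
  exact le_iSup₂ (f := fun g (_ : g ∈ 𝒢) =>
    ENNReal.ofReal |∑ i, symKernel (tupleValue z (Sum.elim x y) g) i|) g hg

end Symmetrization

/-! ### Integration over the sample -/

/-- The Cauchy–Schwarz inequality for a measurable `Φ` dominated by `κ S ^ (1 / 2) ρ`, in a form that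
does not need `S` to be measurable: it is applied to `Φ / ρ` and `ρ`, and `(Φ / ρ) ^ 2 ≤ κ ^ 2 S`. -/
lemma lintegral_le_of_le_sqrt_mul {Ω : Type*} [MeasurableSpace Ω] {ν : Measure Ω}
    {Φ S ρ : Ω → ENNReal} {κ : ENNReal} (hΦ : AEMeasurable Φ ν) (hρ : Measurable ρ)
    (hρtop : ∀ x, ρ x ≠ ⊤) (hκ : κ ≠ ⊤) (h : ∀ x, Φ x ≤ κ * S x ^ ((1 : ℝ) / 2) * ρ x) :
    ∫⁻ x, Φ x ∂ν ≤
      κ * (∫⁻ x, S x ∂ν) ^ ((1 : ℝ) / 2) * (∫⁻ x, ρ x ^ (2 : ℝ) ∂ν) ^ ((1 : ℝ) / 2) := by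
  have hΦρ : ∀ x, Φ x ≤ (Φ x / ρ x) * ρ x := fun x => by
    rcases eq_or_ne (ρ x) 0 with h0 | h0
    · have := h x
      rw [h0, mul_zero] at this
      exact this.trans zero_le
    · rw [ENNReal.div_mul_cancel h0 (hρtop x)]
  have hsq : ∀ x, (Φ x / ρ x) ^ (2 : ℝ) ≤ κ ^ (2 : ℝ) * S x := fun x => by
    calc (Φ x / ρ x) ^ (2 : ℝ) ≤ (κ * S x ^ ((1 : ℝ) / 2)) ^ (2 : ℝ) := by
          gcongr
          exact ENNReal.div_le_of_le_mul (h x)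
      _ = _ := by
          rw [ENNReal.mul_rpow_of_nonneg _ _ (by norm_num), ← ENNReal.rpow_mul]
          norm_num
  calc ∫⁻ x, Φ x ∂ν ≤ ∫⁻ x, ((fun x => Φ x / ρ x) * ρ) x ∂ν := lintegral_mono hΦρ
    _ ≤ (∫⁻ x, (Φ x / ρ x) ^ (2 : ℝ) ∂ν) ^ ((1 : ℝ) / 2) *
        (∫⁻ x, ρ x ^ (2 : ℝ) ∂ν) ^ ((1 : ℝ) / 2) :=
      ENNReal.lintegral_mul_le_Lp_mul_Lq ν Real.HolderConjugate.two_two (hΦ.div hρ.aemeasurable)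
        hρ.aemeasurable
    _ ≤ (κ ^ (2 : ℝ) * ∫⁻ x, S x ∂ν) ^ ((1 : ℝ) / 2) *
        (∫⁻ x, ρ x ^ (2 : ℝ) ∂ν) ^ ((1 : ℝ) / 2) := by
      rw [← lintegral_const_mul' _ _ (ENNReal.rpow_ne_top_of_nonneg (by norm_num) hκ)]
      gcongr with x
      exact hsq x
    _ = _ := by
      rw [ENNReal.mul_rpow_of_nonneg _ _ (by norm_num), ← ENNReal.rpow_mul]
      norm_num

/-- The normalization of the `U`-statistic of order `k` is of the order of `n ^ (k / 2)`, up to a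
constant depending on `k` only. -/
lemma rpow_mul_inv_descFactorial_le {k n : ℕ} (hkn : k ≤ n) :
    (n : ℝ) ^ ((k : ℝ) / 2) * (n.descFactorial k : ℝ)⁻¹ * √((2 * n).descFactorial k) ≤
      (k : ℝ) ^ k * √(2 ^ k) := by
  have h1 : (n : ℝ) ^ k ≤ (k : ℝ) ^ k * n.descFactorial k := by
    have : n ^ k ≤ k ^ k * n.descFactorial k := by
      rcases Nat.eq_zero_or_pos k with rfl | hk
      · simp
      refine le_trans ?_ (Nat.mul_le_mul_left _ (Nat.pow_sub_le_descFactorial n k))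
      rw [← mul_pow]
      refine Nat.pow_le_pow_left ?_ k
      obtain ⟨m, rfl⟩ := Nat.exists_eq_add_of_le hkn
      have : k + m + 1 - k = m + 1 := by omega
      rw [this]; nlinarith
    exact_mod_cast this
  have h2 : ((2 * n).descFactorial k : ℝ) ≤ 2 ^ k * (n : ℝ) ^ k := by
    have := Nat.descFactorial_le_pow (2 * n) k
    rw [mul_pow] at this
    exact_mod_cast this
  have hpos : (0 : ℝ) < n.descFactorial k := by
    exact_mod_cast Nat.pos_of_ne_zero fun h => by
      rw [Nat.descFactorial_eq_zero_iff_lt] at h; omega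
  have h3 : (n : ℝ) ^ ((k : ℝ) / 2) = √((n : ℝ) ^ k) := by
    rw [Real.sqrt_eq_rpow, ← Real.rpow_natCast, ← Real.rpow_mul (by positivity)]
    congr 1; ring
  calc _ ≤ √((n : ℝ) ^ k) * (n.descFactorial k : ℝ)⁻¹ * √(2 ^ k * (n : ℝ) ^ k) := by
        rw [h3]; gcongr
    _ = (n : ℝ) ^ k * (n.descFactorial k : ℝ)⁻¹ * √(2 ^ k) := by
        rw [Real.sqrt_mul (by positivity)]
        have := Real.mul_self_sqrt (show (0 : ℝ) ≤ (n : ℝ) ^ k by positivity)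
        linear_combination ((n.descFactorial k : ℝ)⁻¹ * √(2 ^ k)) * this
    _ ≤ _ := by
        gcongr
        rw [← div_eq_mul_inv, div_le_iff₀ hpos]
        exact h1

section Envelope

variable {k n q : ℕ}

lemma measurable_uStat {z : Fin n → Fin q → ℝ} {g : (Fin k → ℝ × (Fin q → ℝ)) → ℝ}
    (hg : Measurable g) : Measurable fun u => uStat (points (doubled z) u) g := by
  simp only [uStat_eq]
  exact (Finset.measurable_sum _ fun I _ => measurable_tupleValue z hg I).const_mul _

/-- The envelope is integrable at every tuple of distinct points of the doubled sample, being square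
integrable there. -/
lemma integrable_tupleValue {μ : Measure ℝ} [IsProbabilityMeasure μ] {z : Fin n → Fin q → ℝ}
    {G : (Fin k → ℝ × (Fin q → ℝ)) → ℝ} (hG : Measurable G)
    (hfin : ∫⁻ u, ENNReal.ofReal (uStat (points (doubled z) u) fun s => G s ^ 2)
      ∂(Measure.pi fun _ : Fin n ⊕ Fin n => μ) ≠ ⊤) (I : Fin k ↪ Fin n ⊕ Fin n) :
    Integrable (fun u => tupleValue z u G I) (Measure.pi fun _ : Fin n ⊕ Fin n => μ) := by
  have hm := measurable_tupleValue z hG I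
  refine MemLp.integrable one_le_two ((memLp_two_iff_integrable_sq hm.aestronglyMeasurable).2 ?_)
  have hint : Integrable (fun u => uStat (points (doubled z) u) fun s => G s ^ 2)
      (Measure.pi fun _ : Fin n ⊕ Fin n => μ) :=
    (lintegral_ofReal_ne_top_iff_integrable
      (measurable_uStat (hG.pow_const 2)).aestronglyMeasurable
      (Filter.Eventually.of_forall fun u => uStat_nonneg _ fun _ => sq_nonneg _)).1 hfin
  refine (hint.const_mul ((Fintype.card (Fin n ⊕ Fin n)).descFactorial k : ℝ)).mono
    (hm.pow_const 2).aestronglyMeasurable (Filter.Eventually.of_forall fun u => ?_)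
  have hpos : (0 : ℝ) < (Fintype.card (Fin n ⊕ Fin n)).descFactorial k := by
    have := Fintype.card_le_of_embedding I
    rw [Fintype.card_fin] at this
    exact_mod_cast Nat.pos_of_ne_zero fun h => by
      rw [Nat.descFactorial_eq_zero_iff_lt] at h; omega
  rw [uStat_eq, mul_inv_cancel_left₀ hpos.ne', Real.norm_of_nonneg (sq_nonneg _),
    Real.norm_of_nonneg (Finset.sum_nonneg fun _ _ => sq_nonneg _)]
  exact Finset.single_le_sum (f := fun I => tupleValue z u G I ^ 2) (fun _ _ => sq_nonneg _)
    (Finset.mem_univ I)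

end Envelope

end CondUStat

theorem lemma4 (k : ℕ) (hk : 1 ≤ k) (α : ℝ) (hα : α ∈ Set.Ioo (0 : ℝ) 1)
    (c d M : ℝ) (hc : 0 < c) (hd : 0 < d) :
    ∃ Λ : ℝ, 0 < Λ ∧
      ∀ (q : ℕ) (𝒢 : Set ((Fin k → ℝ × (Fin q → ℝ)) → ℝ)) (G : (Fin k → ℝ × (Fin q → ℝ)) → ℝ),
        (∀ g ∈ 𝒢, Measurable g) → Measurable G → CondUStat.IsEuclidean c d 𝒢 G →
      ∀ (n : ℕ) (_ : k ≤ n) (z : Fin n → Fin q → ℝ)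
        (Ω : Type*) [MeasurableSpace Ω] (P : Measure Ω) [IsProbabilityMeasure P]
        (μ : Measure ℝ) [IsProbabilityMeasure μ] (u : Fin n ⊕ Fin n → Ω → ℝ),
        (∀ i, Measurable (u i)) → (∀ i, P.map (u i) = μ) → iIndepFun u P →
        CondUStat.IsMeasurableClass μ (CondUStat.doubled z) 𝒢 →
        (∫⁻ ω, ENNReal.ofReal (CondUStat.uStat
            (CondUStat.points (CondUStat.doubled z) fun i => u i ω) fun s => G s ^ 2) ∂P
          ≤ ENNReal.ofReal M) →
        (∀ g ∈ 𝒢, ∀ i : Fin k ↪ Fin n,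
          CondUStat.IsDegenerate μ fun x : Fin k → ℝ => g fun j => (x j, z (i j))) →
        ∫⁻ ω, (⨆ g ∈ 𝒢, ENNReal.ofReal
            |(n : ℝ) ^ ((k : ℝ) / 2) *
              CondUStat.uStat (CondUStat.points z fun i => u (Sum.inl i) ω) g|) ∂P
          ≤ ENNReal.ofReal Λ *
            (∫⁻ ω, (⨆ g ∈ 𝒢, ENNReal.ofReal
              (CondUStat.uStat (CondUStat.points (CondUStat.doubled z) fun i => u i ω)
                (fun s => g s ^ 2) ^ α)) ∂P) ^ ((1 : ℝ) / 2) := by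
  obtain ⟨K, hK, hcond⟩ := CondUStat.exists_sum_biSup_chaos_le k hα hc.le d
  -- The summand `1` only ensures positivity.
  refine ⟨(k : ℝ) ^ k * √(2 ^ k) * K * √(1 + max M 0) + 1, by positivity, ?_⟩
  intro q 𝒢 G h𝒢 hG hE n hkn z Ω _ P _ μ _ u hu hlaw hind hcls hM hdeg
  set π : Measure (Fin n ⊕ Fin n → ℝ) := Measure.pi fun _ => μ with hπ
  have hum : Measurable fun ω i => u i ω := measurable_pi_iff.2 hu
  have hmap : P.map (fun ω i => u i ω) = π := by
    rw [hind.map_fun_eq_pi_map fun i => (hu i).aemeasurable]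
    simp only [hlaw, hπ]
  -- The mean of the squared envelope, as an integral over the product law.
  have hrm : Measurable fun x => ENNReal.ofReal
      (CondUStat.uStat (CondUStat.points (CondUStat.doubled z) x) fun s => G s ^ 2) :=
    (CondUStat.measurable_uStat (hG.pow_const 2)).ennreal_ofReal
  have hr : ∫⁻ x, ENNReal.ofReal
      (CondUStat.uStat (CondUStat.points (CondUStat.doubled z) x) fun s => G s ^ 2) ∂π ≤
      ENNReal.ofReal M := by
    rw [← hmap, lintegral_map hrm hum]; exact hM
  set F₀ : (Fin n ⊕ Fin n → ℝ) → ENNReal := fun x =>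
    ⨆ g ∈ 𝒢, ENNReal.ofReal |∑ i, CondUStat.tupleValue z x g (CondUStat.pickEmb 1 i)| with hF₀
  have hF₀m : AEMeasurable F₀ π := CondUStat.aemeasurable_firstHalf hcls
  set a : ℝ := (n : ℝ) ^ ((k : ℝ) / 2) * (n.descFactorial k : ℝ)⁻¹ with ha
  have ha0 : 0 ≤ a := by positivity
  have hleft : ∫⁻ ω, (⨆ g ∈ 𝒢, ENNReal.ofReal |(n : ℝ) ^ ((k : ℝ) / 2) *
      CondUStat.uStat (CondUStat.points z fun i => u (Sum.inl i) ω) g|) ∂P =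
      ENNReal.ofReal a * ∫⁻ x, F₀ x ∂π := by
    rw [← lintegral_const_mul'' _ hF₀m, ← hmap,
      lintegral_map' ((hmap ▸ hF₀m).const_mul _) hum.aemeasurable]
    refine lintegral_congr fun ω => ?_
    simp only [hF₀, ENNReal.mul_iSup]
    refine iSup_congr fun g => iSup_congr fun _ => ?_
    rw [CondUStat.uStat_eq, Fintype.card_fin, ← mul_assoc, ← ha, abs_mul, abs_of_nonneg ha0,
      ENNReal.ofReal_mul ha0]
    rfl
  set S : (Fin n ⊕ Fin n → ℝ) → ENNReal := fun x => ⨆ g ∈ 𝒢, ENNReal.ofReal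
    (CondUStat.uStat (CondUStat.points (CondUStat.doubled z) x) (fun s => g s ^ 2) ^ α) with hS
  have hright : ∫⁻ x, S x ∂π ≤ ∫⁻ ω, S (fun i => u i ω) ∂P := by
    rw [← hmap]; exact lintegral_map_le _ _
  set ρ : (Fin n ⊕ Fin n → ℝ) → ENNReal := fun x => ENNReal.ofReal
    (CondUStat.uStat (CondUStat.points (CondUStat.doubled z) x) fun s => G s ^ 2) ^ ((1 - α) / 2)
    with hρ
  set κ : ENNReal := ENNReal.ofReal (K * √((2 * n).descFactorial k)) with hκ
  set m : ENNReal := (Fintype.card (Fin n → ℤˣ) : ENNReal) with hm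
  have hm0 : m ≠ 0 := by simp [hm]
  have hmtop : m ≠ ⊤ := by simp [hm]
  -- The mean over the signs of the supremum of the CondUStat.chaos.
  set Φ : (Fin n ⊕ Fin n → ℝ) → ENNReal := fun x => m⁻¹ * ∑ σ, ⨆ g ∈ 𝒢,
    ENNReal.ofReal |CondUStat.chaos (CondUStat.symKernel (CondUStat.tupleValue z x g)) σ| with hΦ
  have hsum : AEMeasurable (fun x => ∑ σ, ⨆ g ∈ 𝒢,
      ENNReal.ofReal |CondUStat.chaos (CondUStat.symKernel (CondUStat.tupleValue z x g)) σ|) π :=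
    Finset.aemeasurable_fun_sum _ fun σ _ => CondUStat.aemeasurable_chaos hcls σ
  have hΦm : AEMeasurable Φ π := hsum.const_mul _
  have hF₀Φ : ∫⁻ x, F₀ x ∂π ≤ ∫⁻ x, Φ x ∂π := by
    refine (CondUStat.lintegral_firstHalf_le h𝒢 hE.envelope hcls
      (CondUStat.integrable_tupleValue hG (ne_top_of_le_ne_top ENNReal.ofReal_ne_top hr))
      hdeg).trans_eq ?_
    rw [lintegral_const_mul'' _ hsum, lintegral_finsetSum' _ fun σ _ =>
      CondUStat.aemeasurable_chaos hcls σ]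
    simp only [CondUStat.lintegral_chaos_eq, Finset.sum_const, Finset.card_univ, nsmul_eq_mul]
    rw [← hm, ← mul_assoc, ENNReal.inv_mul_cancel hm0 hmtop, one_mul]
  have hΦle : ∀ x, Φ x ≤ κ * S x ^ ((1 : ℝ) / 2) * ρ x := fun x => by
    refine (mul_le_mul_right (hcond _ 𝒢 G hE n _) m⁻¹).trans_eq ?_
    rw [← hm, ← mul_assoc, ENNReal.inv_mul_cancel hm0 hmtop, one_mul]
  have hα1 := hα.2
  have hCS := CondUStat.lintegral_le_of_le_sqrt_mul hΦm (hrm.pow_const _)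
    (fun x => ENNReal.rpow_ne_top_of_nonneg (by linarith) ENNReal.ofReal_ne_top)
    ENNReal.ofReal_ne_top hΦle
  have hρ2 : ∫⁻ x, ρ x ^ (2 : ℝ) ∂π ≤ ENNReal.ofReal (1 + max M 0) := by
    calc ∫⁻ x, ρ x ^ (2 : ℝ) ∂π ≤ ∫⁻ x, (1 + ENNReal.ofReal
          (CondUStat.uStat (CondUStat.points (CondUStat.doubled z) x) fun s => G s ^ 2)) ∂π := by
          refine lintegral_mono fun x => ?_
          simp only [hρ]
          rw [← ENNReal.rpow_mul, div_mul_cancel₀ _ two_ne_zero]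
          generalize ENNReal.ofReal _ = t
          rcases le_total t 1 with ht | ht
          · exact (ENNReal.rpow_le_one ht (by linarith)).trans le_self_add
          · refine (ENNReal.rpow_le_rpow_of_exponent_le ht
              (show 1 - α ≤ 1 by linarith [hα.1])).trans ?_
            rw [ENNReal.rpow_one]
            exact le_add_self
      _ ≤ 1 + ENNReal.ofReal M := by
          rw [lintegral_add_left measurable_const]
          simpa using hr
      _ ≤ _ := by
          rw [ENNReal.ofReal_add zero_le_one (le_max_right _ _), ENNReal.ofReal_one]
          gcongr
          exact le_max_left _ _
  have hconst : a * (K * √((2 * n).descFactorial k)) ≤ (k : ℝ) ^ k * √(2 ^ k) * K := by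
    have := mul_le_mul_of_nonneg_right (CondUStat.rpow_mul_inv_descFactorial_le hkn) hK
    rw [ha]
    linarith
  rw [hleft]
  calc ENNReal.ofReal a * ∫⁻ x, F₀ x ∂π
      ≤ ENNReal.ofReal a * (κ * (∫⁻ ω, S (fun i => u i ω) ∂P) ^ ((1 : ℝ) / 2) *
        ENNReal.ofReal (1 + max M 0) ^ ((1 : ℝ) / 2)) := by
        gcongr
        refine hF₀Φ.trans (hCS.trans ?_)
        gcongr
    _ = ENNReal.ofReal (a * (K * √((2 * n).descFactorial k)) * √(1 + max M 0)) *
        (∫⁻ ω, S (fun i => u i ω) ∂P) ^ ((1 : ℝ) / 2) := by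
        rw [ENNReal.ofReal_mul (p := a * _) (by positivity), ENNReal.ofReal_mul (p := a) ha0,
          Real.sqrt_eq_rpow (1 + _), ← ENNReal.ofReal_rpow_of_nonneg (by positivity) (by norm_num), ← hκ]
        ring
    _ ≤ _ := by
        gcongr
        refine (mul_le_mul_of_nonneg_right hconst (Real.sqrt_nonneg _)).trans ?_
        linarith
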